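/- Let $k$ be a commutative domain in which $2$ is invertible, let $n$ be a positive even integer, and let $B=k_{-1}[x_1,\dots,x_n]$ be the $k$-algebra generated by $x_1,\dots,x_n$ subject to $x_ix_j+x_jx_i=0$ for $i<j$. *Terminology.* A filtered algebra is a $k$-algebra $T$ with an exhaustive increasing filtration $F_0T\subseteq F_1T\subseteq\cdots$ by $k$-submodules, with $1\in F_0T$ and $F_iT\,F_jT\subseteq F_{i+j}T$; $\deg a$ is the least $i$ with $a\in F_iT$. Its associated graded ring $\operatorname{gr}T=\bigoplus_i F_iT/F_{i-1}T$ (with $F_{-1}T=0$) is a *connected graded domain* if it is a domain and the map $k\to F_0T$, $c\mapsto c\cdot 1$, is bijective. Let $A$ be a $k$-algebra generated by elements $x_1,\dots,x_m$ that are linearly independent over $k$, with $Y=\bigoplus_i kx_i$ satisfying $Y\cap k\cdot 1=0$, filtered by $F_iA=(k\cdot 1+Y)^i$. A nonzero $f\in A$ is *dominating* if for every filtered PI algebra $T$ over $k$ (one satisfying a polynomial identity in noncommuting variables with integer coefficients, some monomial of highest degree having coefficient $1$) whose $\operatorname{gr}T$ is a connected graded domain, and all $y_1,\dots,y_m\in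 T$ whose images in $T/F_0T$ are linearly independent over $k$, there is a lift $p$ of $f$ to the free algebra $k\langle x_1,\dots,x_m\rangle$ such that either $p(y_1,\dots,y_m)=0$, or $\deg p(y_1,\dots,y_m)\ge\deg f$, with strict inequality if $\deg y_i>1$ for some $i$. The category $\mathbf{Af}$ consists of the $k$-flat algebras $A$, filtered in this way, such that $\operatorname{gr}A$ is a connected graded domain, $A$ is a finitely generated free module over its center $R$, and, with $w=\operatorname{rk}_R A$ and $\operatorname{tr}\colon A\to R$ the regular trace (the trace of left multiplication), the ideal of $R$ generated by all $\det(\operatorname{tr}(z_iz_j))_{1\le i,j\le w}$ with $z_1,\dots,z_w\in A$ is generated by one element that is dominating in $A$; its morphisms are the algebra isomorphisms. **Theorem.** $B$, filtered by means of the generators $x_1,\dots,x_n$, is in $\mathbf{Af}$, and the following hold. 1. $\operatorname{Aut}(B)=S_n\ltimes(k^\times)^n$. That is, let $S_n$ act on $(k^\times)^n$ by permuting the coordinates; then the map that sends $(r,\sigma)$ to the $k$-algebra automorphism $x_i\mapsto r_{\sigma(i)}x_{\sigma(i)}$ is a group isomorphism from $S_n\ltimes(k^\times)^n$ onto the group of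 $k$-algebra automorphisms of $B$. 2. For the polynomial extension $B[t]$ by a central variable $t$, $$\operatorname{Aut}(B[t])=\begin{pmatrix} S_n\ltimes(k^\times)^n & k[x_1^2,\dots,x_n^2]\\ 0& k^\times\end{pmatrix}.$$ That is, the set of triples $(g,r,c)$ with $g\in S_n\ltimes(k^\times)^n$, $r\in k[x_1^2,\dots,x_n^2]\subseteq B$ and $c\in k^\times$ is a group under $(g_1,r_1,c_1)(g_2,r_2,c_2)=(g_1g_2,\;g_1(r_2)+r_1c_2,\;c_1c_2)$, where $g$ acts on $B$ as in (1), and sending $(g,r,c)$ to the automorphism with $b\mapsto g(b)$ for $b\in B$ and $t\mapsto ct+r$ is a group isomorphism onto the group of $k$-algebra automorphisms of $B[t]$. 3. If $\mathbb{Q}\subseteq k$, then every locally nilpotent derivation of $B$ is zero, i.e. every $k$-linear $\partial\colon B\to B$ with $\partial(ab)=\partial(a)b+a\partial(b)$ for all $a,b\in B$, and such that for every $a\in B$ some $\partial^m(a)=0$, is zero. -/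

import Mathlib

open scoped DirectSum

noncomputable section

namespace DiscAut

/-! ### Filtered algebras and their associated graded rings -/

/-- An increasing multiplicative filtration `F₀ ⊆ F₁ ⊆ ⋯` of a `k`-algebra by `k`-submodules,
with `1 ∈ F₀`. -/
structure AlgFiltration (k T : Type*) [CommRing k] [Ring T] [Algebra k T] where
  F : ℕ → Submodule k T
  mono : Monotone F
  one_mem : (1 : T) ∈ F 0
  mul_mem : ∀ {i j : ℕ} {a b : T}, a ∈ F i → b ∈ F j → a * b ∈ F (i + j)

namespace AlgFiltration

variable {k T : Type*} [CommRing k] [Ring T] [Algebra k T] (Φ : AlgFiltration k T)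

/-- The filtration is exhaustive. -/
def IsExhaustive : Prop := ∀ a : T, ∃ i, a ∈ Φ.F i

/-- `F_{n-1}`, with `F_{-1} = 0`. -/
def lt : ℕ → Submodule k T
  | 0 => ⊥
  | n + 1 => Φ.F n

/-- The degree of an element: the `n` with `a ∈ Fₙ \ Fₙ₋₁`, i.e. the least `n` with `a ∈ Fₙ`
(a meaningful notion for `a ≠ 0` and an exhaustive filtration). -/
def deg (a : T) : ℕ := sInf {n | a ∈ Φ.F n}

lemma lt_le (n : ℕ) : Φ.lt n ≤ Φ.F n := by
  cases n with
  | zero => exact bot_le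
  | succ n => exact Φ.mono (Nat.le_succ n)

lemma lt_mul_mem {i j : ℕ} {a b : T} (ha : a ∈ Φ.lt i) (hb : b ∈ Φ.F j) :
    a * b ∈ Φ.lt (i + j) := by
  cases i with
  | zero =>
    have h : a = 0 := by simpa [lt] using ha
    rw [h, zero_mul]; exact zero_mem _
  | succ i =>
    rw [show i + 1 + j = (i + j) + 1 by omega]
    exact Φ.mul_mem ha hb

lemma mul_lt_mem {i j : ℕ} {a b : T} (ha : a ∈ Φ.F i) (hb : b ∈ Φ.lt j) :
    a * b ∈ Φ.lt (i + j) := by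
  cases j with
  | zero =>
    have h : b = 0 := by simpa [lt] using hb
    rw [h, mul_zero]; exact zero_mem _
  | succ j => exact Φ.mul_mem ha hb

/-- The degree `n` piece `Fₙ / Fₙ₋₁` of the associated graded ring. -/
abbrev gr (n : ℕ) : Type _ := Φ.F n ⧸ (Φ.lt n).comap (Φ.F n).subtype

/-- The class in `Fₙ / Fₙ₋₁` of an element of `Fₙ`. -/
def cls {n : ℕ} (a : T) (ha : a ∈ Φ.F n) : Φ.gr n := Submodule.Quotient.mk ⟨a, ha⟩

lemma exists_cls {n : ℕ} (x : Φ.gr n) : ∃ a, ∃ ha : a ∈ Φ.F n, x = Φ.cls a ha := by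
  obtain ⟨⟨a, ha⟩, rfl⟩ := Submodule.Quotient.mk_surjective _ x
  exact ⟨a, ha, rfl⟩

/-- The multiplication `(Fᵢ / Fᵢ₋₁) × (Fⱼ / Fⱼ₋₁) → Fᵢ₊ⱼ / Fᵢ₊ⱼ₋₁` induced by that of `T`. -/
def grMul {i j : ℕ} (x : Φ.gr i) (y : Φ.gr j) : Φ.gr (i + j) :=
  Quotient.map₂ (fun a b : _ => (⟨a.1 * b.1, Φ.mul_mem a.2 b.2⟩ : Φ.F (i + j)))
    (by
      intro a a' h b b' h'
      have h := (Submodule.quotientRel_def _).mp h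
      have h' := (Submodule.quotientRel_def _).mp h'
      refine (Submodule.quotientRel_def _).mpr ?_
      rw [Submodule.mem_comap] at h h' ⊢
      have e : a.1 * b.1 - a'.1 * b'.1 = (a.1 - a'.1) * b.1 + a'.1 * (b.1 - b'.1) := by
        noncomm_ring
      simp only [Submodule.subtype_apply, AddSubgroupClass.coe_sub] at h h' ⊢
      rw [e]
      exact add_mem (Φ.lt_mul_mem h b.2) (Φ.mul_lt_mem a'.2 h')) x y

lemma grMul_cls {i j : ℕ} {a b : T} (ha : a ∈ Φ.F i) (hb : b ∈ Φ.F j) :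
    Φ.grMul (Φ.cls a ha) (Φ.cls b hb) = Φ.cls (a * b) (Φ.mul_mem ha hb) := rfl

lemma cls_add {i : ℕ} {a b : T} (ha : a ∈ Φ.F i) (hb : b ∈ Φ.F i) :
    Φ.cls a ha + Φ.cls b hb = Φ.cls (a + b) (add_mem ha hb) := rfl

lemma cls_zero {i : ℕ} : Φ.cls (0 : T) (zero_mem (Φ.F i)) = 0 := rfl

lemma cls_congr {i : ℕ} {a b : T} (h : a = b) (ha : a ∈ Φ.F i) (hb : b ∈ Φ.F i) :
    Φ.cls a ha = Φ.cls b hb := by subst h; rfl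

lemma sigma_cls {i j : ℕ} {a b : T} (hij : i = j) (h : a = b) (ha : a ∈ Φ.F i)
    (hb : b ∈ Φ.F j) :
    (⟨i, Φ.cls a ha⟩ : GradedMonoid Φ.gr) = ⟨j, Φ.cls b hb⟩ := by
  subst hij; subst h; rfl

lemma natCast_mem (n : ℕ) : (n : T) ∈ Φ.F 0 := by
  rw [← nsmul_one]; exact nsmul_mem Φ.one_mem n

lemma algebraMap_mem (c : k) : algebraMap k T c ∈ Φ.F 0 := by
  rw [Algebra.algebraMap_eq_smul_one]; exact Submodule.smul_mem _ c Φ.one_mem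

instance grGMul : GradedMonoid.GMul Φ.gr := ⟨fun x y => Φ.grMul x y⟩

instance grGOne : GradedMonoid.GOne Φ.gr := ⟨Φ.cls 1 Φ.one_mem⟩

instance grGMonoid : GradedMonoid.GMonoid Φ.gr where
  one_mul := by
    rintro ⟨i, x⟩
    obtain ⟨a, ha, rfl⟩ := Φ.exists_cls x
    exact Φ.sigma_cls (zero_add i) (one_mul a) _ _
  mul_one := by
    rintro ⟨i, x⟩
    obtain ⟨a, ha, rfl⟩ := Φ.exists_cls x
    exact Φ.sigma_cls (add_zero i) (mul_one a) _ _
  mul_assoc := by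
    rintro ⟨i, x⟩ ⟨j, y⟩ ⟨l, z⟩
    obtain ⟨a, ha, rfl⟩ := Φ.exists_cls x
    obtain ⟨b, hb, rfl⟩ := Φ.exists_cls y
    obtain ⟨c, hc, rfl⟩ := Φ.exists_cls z
    exact Φ.sigma_cls (add_assoc i j l) (mul_assoc a b c) _ _

/-- The graded ring structure on `gr T = ⨁ₙ Fₙ / Fₙ₋₁`. -/
instance grGSemiring : DirectSum.GSemiring Φ.gr where
  mul_zero x := by
    obtain ⟨a, ha, rfl⟩ := Φ.exists_cls x
    rw [← cls_zero, ← cls_zero]; exact Φ.cls_congr (mul_zero a) _ _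
  zero_mul x := by
    obtain ⟨a, ha, rfl⟩ := Φ.exists_cls x
    rw [← cls_zero, ← cls_zero]; exact Φ.cls_congr (zero_mul a) _ _
  mul_add x y z := by
    obtain ⟨a, ha, rfl⟩ := Φ.exists_cls x
    obtain ⟨b, hb, rfl⟩ := Φ.exists_cls y
    obtain ⟨c, hc, rfl⟩ := Φ.exists_cls z
    exact Φ.cls_congr (mul_add a b c) _ _
  add_mul x y z := by
    obtain ⟨a, ha, rfl⟩ := Φ.exists_cls x
    obtain ⟨b, hb, rfl⟩ := Φ.exists_cls y
    obtain ⟨c, hc, rfl⟩ := Φ.exists_cls z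
    exact Φ.cls_congr (add_mul a b c) _ _
  natCast n := Φ.cls (n : T) (Φ.natCast_mem n)
  natCast_zero := Φ.cls_congr Nat.cast_zero _ _
  natCast_succ n := Φ.cls_congr (Nat.cast_succ n) _ _

/-- `gr T` is a connected graded domain: the ring `⨁ₙ Fₙ / Fₙ₋₁` is a domain, and its degree
zero piece is `k`. -/
def IsConnectedGradedDomain : Prop :=
  IsDomain (⨁ n, Φ.gr n) ∧
    Function.Bijective fun c : k => Φ.cls (algebraMap k T c) (Φ.algebraMap_mem c)

end AlgFiltration

/-- The standard filtration `Fₙ = (k ⊕ Y)ⁿ`, where `Y` is the span of the family `x`. -/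
def stdFiltration (k : Type*) {A ι : Type*} [CommRing k] [Ring A] [Algebra k A] (x : ι → A) :
    AlgFiltration k A where
  F n := (1 ⊔ Submodule.span k (Set.range x)) ^ n
  mono := by
    intro m n h
    exact pow_le_pow_right' (le_sup_left : (1 : Submodule k A) ≤ _) h
  one_mem := by rw [pow_zero]; exact Submodule.one_le.mp le_rfl
  mul_mem := by
    intro i j a b ha hb
    rw [pow_add]; exact Submodule.mul_mem_mul ha hb

/-! ### Dominating elements and discriminants -/

/-- `T` is a PI ring: it satisfies a polynomial identity `f` with integer coefficients, some
monomial of highest degree of which has coefficient `1`. -/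
def IsPI (T : Type*) [Ring T] : Prop :=
  ∃ f : FreeAlgebra ℤ ℕ,
    (∃ w : FreeMonoid ℕ,
      (FreeAlgebra.equivMonoidAlgebraFreeMonoid f).coeff w = 1 ∧
      ∀ w' : FreeMonoid ℕ, (FreeAlgebra.equivMonoidAlgebraFreeMonoid f).coeff w' ≠ 0 →
        w'.length ≤ w.length) ∧
    ∀ v : ℕ → T, FreeAlgebra.lift ℤ v f = 0

/-- `f` is a dominating element of the algebra `A`, filtered by the standard filtration of its
generators `x₁, …, x_m`. The testing algebras `T` range over the universe `w`. -/
def IsDominating.{u, v, w} (k : Type u) {A : Type v} [CommRing k] [Ring A] [Algebra k A] {m : ℕ}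
    (x : Fin m → A) (f : A) : Prop :=
  f ≠ 0 ∧
    ∀ (T : Type w) [Ring T] [Algebra k T] (Ψ : AlgFiltration k T),
      IsPI T → Ψ.IsExhaustive → Ψ.IsConnectedGradedDomain →
      ∀ y : Fin m → T, LinearIndependent k (fun i => (Ψ.F 0).mkQ (y i)) →
        ∃ p : FreeAlgebra k (Fin m), FreeAlgebra.lift k x p = f ∧
          (FreeAlgebra.lift k y p = 0 ∨
            ((stdFiltration k x).deg f ≤ Ψ.deg (FreeAlgebra.lift k y p) ∧
              ((∃ i, 1 < Ψ.deg (y i)) →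
                (stdFiltration k x).deg f < Ψ.deg (FreeAlgebra.lift k y p))))

/-- The regular trace `tr : A → R` of an algebra `A` that is finitely generated free over a central
subalgebra `R`: the trace of the left multiplication by the given element. -/
def regTrace (R A : Type*) [CommRing R] [Ring A] [Algebra R A] : A →ₗ[R] R :=
  (LinearMap.trace R A).comp (Algebra.lmul R A).toLinearMap

/-- The `w`-discriminant ideal `D_w(A, tr)` of an algebra `A` over a central subalgebra `R`, for
the regular trace `tr : A → R`. -/
def discIdeal (R A : Type*) [CommRing R] [Ring A] [Algebra R A] (w : ℕ) : Ideal R :=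
  Ideal.span (Set.range fun z : Fin w → A =>
    (Matrix.of fun i j => regTrace R A (z i * z j)).det)

/-- The discriminant of `A` over its center `R` is dominating: with `w` the rank of `A` over `R`,
the `w`-discriminant ideal is generated by an element that is dominating in `A`. -/
def HasDominatingDiscriminant.{u, v, w} (k : Type u) {A : Type v} [CommRing k] [Ring A]
    [Algebra k A] {m : ℕ} (x : Fin m → A) : Prop :=
  ∃ d : Subring.center A,
    discIdeal (Subring.center A) A (Module.finrank (Subring.center A) A)
        = Ideal.span {d} ∧
      IsDominating.{u, v, w} k x (d : A)

/-- The `k`-algebra `A`, filtered by means of the generators `x₁, …, x_m` (that is, with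
`Y = ⨁ k xᵢ` and the filtration `(k ⊕ Y)ⁿ`), is an object of the category `Af`. -/
structure InAf.{u, v, w} (k : Type u) {A : Type v} [CommRing k] [Ring A] [Algebra k A] {m : ℕ}
    (x : Fin m → A) : Prop where
  flat : Module.Flat k A
  linearIndependent : LinearIndependent k x
  disjoint : Disjoint (1 : Submodule k A) (Submodule.span k (Set.range x))
  generates : Algebra.adjoin k (Set.range x) = ⊤
  exhaustive : (stdFiltration k x).IsExhaustive
  gr_domain : (stdFiltration k x).IsConnectedGradedDomain
  finite : Module.Finite (Subring.center A) A
  free : Module.Free (Subring.center A) A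
  dominating : HasDominatingDiscriminant.{u, v, w} k x

/-! ### The skew polynomial ring -/

/-- The relations `xᵢ xⱼ + xⱼ xᵢ = 0` for `i < j`. -/
inductive SkewRel (k : Type*) [CommRing k] (n : ℕ) :
    FreeAlgebra k (Fin n) → FreeAlgebra k (Fin n) → Prop
  | anticomm (i j : Fin n) (h : i < j) :
      SkewRel k n (FreeAlgebra.ι k i * FreeAlgebra.ι k j + FreeAlgebra.ι k j * FreeAlgebra.ι k i) 0

/-- The skew polynomial ring `k₋₁[x₁, …, xₙ]`. -/
abbrev SkewPoly (k : Type*) [CommRing k] (n : ℕ) : Type _ := RingQuot (SkewRel k n)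

namespace SkewPoly

variable (k : Type*) [CommRing k] (n : ℕ)

/-- The generator `xᵢ`. -/
def x (i : Fin n) : SkewPoly k n := RingQuot.mkAlgHom k (SkewRel k n) (FreeAlgebra.ι k i)

variable {k n}

lemma x_anticomm_of_lt {i j : Fin n} (h : i < j) : x k n i * x k n j + x k n j * x k n i = 0 := by
  have := RingQuot.mkAlgHom_rel k (SkewRel.anticomm (k := k) i j h)
  simpa [x] using this

lemma x_anticomm {i j : Fin n} (h : i ≠ j) : x k n i * x k n j + x k n j * x k n i = 0 := by
  rcases lt_or_gt_of_ne h with h | h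
  · exact x_anticomm_of_lt h
  · rw [add_comm]; exact x_anticomm_of_lt h

lemma algHom_ext {B : Type*} [Ring B] [Algebra k B] {f g : SkewPoly k n →ₐ[k] B}
    (h : ∀ i, f (x k n i) = g (x k n i)) : f = g := by
  apply RingQuot.ringQuot_ext'
  apply FreeAlgebra.hom_ext
  funext i
  exact h i

/-- The group `Sₙ ⋉ (k^×)ⁿ`, with `Sₙ` permuting the coordinates: `(σ • r) i = r (σ⁻¹ i)`. -/
abbrev MonomialGroup (k : Type*) [CommRing k] (n : ℕ) : Type _ :=
  (Fin n → kˣ) ⋊[mulAutArrow] Equiv.Perm (Fin n)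

/-- The endomorphism `xᵢ ↦ r_{σ(i)} x_{σ(i)}` attached to `s = (r, σ)`. -/
def monomialHom (s : MonomialGroup k n) : SkewPoly k n →ₐ[k] SkewPoly k n :=
  RingQuot.liftAlgHom k
    ⟨FreeAlgebra.lift k fun i => (s.left (s.right i) : k) • x k n (s.right i), by
      intro a b h
      induction h with
      | anticomm i j h =>
        have h' : s.right i ≠ s.right j := fun e => h.ne (s.right.injective e)
        simp only [map_add, map_mul, FreeAlgebra.lift_ι_apply, map_zero, smul_mul_smul_comm]
        rw [mul_comm (s.left (s.right j) : k), ← smul_add, x_anticomm h', smul_zero]⟩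

lemma monomialHom_x (s : MonomialGroup k n) (i : Fin n) :
    monomialHom s (x k n i) = (s.left (s.right i) : k) • x k n (s.right i) := by
  simp [monomialHom, x]

lemma monomialHom_mul (s t : MonomialGroup k n) :
    monomialHom (s * t) = (monomialHom s).comp (monomialHom t) := by
  apply algHom_ext
  intro i
  have h : (mulAutArrow (G := Equiv.Perm (Fin n)) (A := Fin n) (M := kˣ) s.right t.left)
      (s.right (t.right i)) = t.left (t.right i) := by
    show t.left (s.right⁻¹ • s.right (t.right i)) = _
    simp
  simp only [AlgHom.comp_apply, monomialHom_x, map_smul, smul_smul, SemidirectProduct.mul_left,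
    SemidirectProduct.mul_right, Equiv.Perm.mul_apply, Pi.mul_apply, h, Units.val_mul, mul_comm]

lemma monomialHom_one : monomialHom (1 : MonomialGroup k n) = AlgHom.id k _ := by
  apply algHom_ext
  intro i
  simp [monomialHom_x]

/-- The action of `Sₙ ⋉ (k^×)ⁿ` on `k₋₁[x₁, …, xₙ]` by algebra automorphisms,
`(r, σ) ↦ (xᵢ ↦ r_{σ(i)} x_{σ(i)})`: the torus scales the generators and `Sₙ` permutes them. -/
def monomialAut : MonomialGroup k n →* (SkewPoly k n ≃ₐ[k] SkewPoly k n) where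
  toFun s := AlgEquiv.ofAlgHom (monomialHom s) (monomialHom s⁻¹)
    (by rw [← monomialHom_mul, mul_inv_cancel, monomialHom_one])
    (by rw [← monomialHom_mul, inv_mul_cancel, monomialHom_one])
  map_one' := by
    ext a
    exact DFunLike.congr_fun monomialHom_one a
  map_mul' s t := by
    ext a
    exact DFunLike.congr_fun (monomialHom_mul s t) a

lemma monomialAut_x (s : MonomialGroup k n) (i : Fin n) :
    monomialAut s (x k n i) = (s.left (s.right i) : k) • x k n (s.right i) :=
  monomialHom_x s i

/-- The subalgebra `k[x₁², …, xₙ²]`. -/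
def squares (k : Type*) [CommRing k] (n : ℕ) : Subalgebra k (SkewPoly k n) :=
  Algebra.adjoin k (Set.range fun i => x k n i ^ 2)

lemma monomialAut_mem_squares (s : MonomialGroup k n) (a : SkewPoly k n) (ha : a ∈ squares k n) :
    monomialAut s a ∈ squares k n := by
  have h : squares k n ≤ (squares k n).comap (monomialAut s : SkewPoly k n →ₐ[k] SkewPoly k n) := by
    refine Algebra.adjoin_le ?_
    rintro _ ⟨i, rfl⟩
    have : monomialAut s (x k n i ^ 2)
        = (s.left (s.right i) : k) ^ 2 • x k n (s.right i) ^ 2 := by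
      rw [map_pow, monomialAut_x, smul_pow]
    show monomialAut s (x k n i ^ 2) ∈ squares k n
    rw [this]
    exact Subalgebra.smul_mem _ (Algebra.subset_adjoin (Set.mem_range_self (f := fun j => x k n j ^ 2) (s.right i))) _
  exact h ha

/-- The action of `Sₙ ⋉ (k^×)ⁿ` on `k[x₁², …, xₙ²]` obtained by restriction. -/
def squaresRep (k : Type*) [CommRing k] (n : ℕ) :
    Representation k (MonomialGroup k n) (squares k n) where
  toFun s := ((monomialAut s).toLinearMap : SkewPoly k n →ₗ[k] SkewPoly k n).restrict
    (p := Subalgebra.toSubmodule (squares k n)) (q := Subalgebra.toSubmodule (squares k n))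
    (monomialAut_mem_squares s)
  map_one' := by
    ext a
    simp
  map_mul' s t := by
    ext a
    exact congrArg (fun e => e (a : SkewPoly k n)) (map_mul monomialAut s t)

end SkewPoly

/-! ### Triangular groups -/

/-- The group of upper triangular matrices `(g, r; 0, c)` with `g ∈ G`, `r ∈ V` and `c ∈ k^×`,
where the group `G` acts on the `k`-module `V` through `ρ`. -/
@[ext] structure TriangularGroup (k : Type*) {G V : Type*} [CommRing k] [Group G] [AddCommGroup V]
    [Module k V] (ρ : Representation k G V) where
  g : G
  r : V
  c : kˣ

namespace TriangularGroup

variable {k G V : Type*} [CommRing k] [Group G] [AddCommGroup V] [Module k V]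
  {ρ : Representation k G V}

/-- `(g₁, r₁; 0, c₁) (g₂, r₂; 0, c₂) = (g₁ g₂, g₁(r₂) + r₁ c₂; 0, c₁ c₂)`. -/
instance : Mul (TriangularGroup k ρ) :=
  ⟨fun a b => ⟨a.g * b.g, ρ a.g b.r + (b.c : k) • a.r, a.c * b.c⟩⟩

instance : One (TriangularGroup k ρ) := ⟨⟨1, 0, 1⟩⟩

instance : Inv (TriangularGroup k ρ) :=
  ⟨fun a => ⟨a.g⁻¹, -((a.c⁻¹ : kˣ) : k) • ρ a.g⁻¹ a.r, a.c⁻¹⟩⟩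

@[simp] lemma mul_g (a b : TriangularGroup k ρ) : (a * b).g = a.g * b.g := rfl
@[simp] lemma mul_r (a b : TriangularGroup k ρ) : (a * b).r = ρ a.g b.r + (b.c : k) • a.r := rfl
@[simp] lemma mul_c (a b : TriangularGroup k ρ) : (a * b).c = a.c * b.c := rfl
@[simp] lemma one_g : (1 : TriangularGroup k ρ).g = 1 := rfl
@[simp] lemma one_r : (1 : TriangularGroup k ρ).r = 0 := rfl
@[simp] lemma one_c : (1 : TriangularGroup k ρ).c = 1 := rfl
@[simp] lemma inv_g (a : TriangularGroup k ρ) : a⁻¹.g = a.g⁻¹ := rfl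
@[simp] lemma inv_r (a : TriangularGroup k ρ) :
    a⁻¹.r = -((a.c⁻¹ : kˣ) : k) • ρ a.g⁻¹ a.r := rfl
@[simp] lemma inv_c (a : TriangularGroup k ρ) : a⁻¹.c = a.c⁻¹ := rfl

instance : Group (TriangularGroup k ρ) :=
  Group.ofLeftAxioms
    (by
      intro a b d
      ext
      · simp [mul_assoc]
      · simp [smul_smul, mul_comm, add_assoc]
      · simp [mul_assoc])
    (by intro a; ext <;> simp)
    (by
      intro a
      ext
      · simp
      · simp [smul_smul]
      · simp)

end TriangularGroup

/-- The triangular group `(Sₙ ⋉ (k^×)ⁿ, k[x₁², …, xₙ²]; 0, k^×)`. -/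
abbrev SkewPoly.Triangular (k : Type*) [CommRing k] (n : ℕ) : Type _ :=
  TriangularGroup k (G := SkewPoly.MonomialGroup k n) (V := SkewPoly.squares k n)
    (SkewPoly.squaresRep k n)

/-! ### Locally nilpotent derivations -/

/-- The `k`-linear map `D` is a locally nilpotent derivation. -/
def IsLocallyNilpotentDerivation {k A : Type*} [CommRing k] [Ring A] [Algebra k A]
    (D : A →ₗ[k] A) : Prop :=
  (∀ a b, D (a * b) = D a * b + a * D b) ∧ ∀ a, ∃ m : ℕ, (D ^ m) a = 0

end DiscAut

end

universe u w

noncomputable section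
namespace DiscAut.SkewPoly
open Finsupp
variable {k : Type*} [CommRing k] {n : ℕ}

/-! ### The monomial basis of the skew polynomial ring -/

/-! Write $B$ for the skew polynomial ring. The ordered monomials form a $k$-basis of $B$ (`mon`),
and products of monomials are monomials up to sign. Only parities of these signs ever matter. Since
$\mathbb{N}^n$ has unique sums, and even two unique sums, $B$ is a domain and every factor of a
monomial is a monomial (`IsMonomial.of_mul`).

For $n$ even, an element is central exactly when only even exponents occur in it
(`even_of_mem_center`, `squares_le_center`). So the center is $k[x_1^2,\dots,x_n^2]$, and the $2^n$
squarefree monomials are a basis over it. The trace form is diagonal in this basis. Since 2 is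
invertible, the discriminant is, up to a unit, the product of the squares of the squarefree
monomials, which is $d=\prod x_i^{2^n}$ up to sign (`IsMonomialBasis.discIdeal_finrank`). Degrees
add when the associated graded ring is a domain, and every $x_i$ occurs in $d$, so $d$ is dominating
(`isDominating_of_eq_prod`).

The discriminant of $B[t]$ over its center is the same $d$. An automorphism $\varphi$ of $B[t]$
preserves the discriminant ideal, so $\varphi(d)$ divides $d$. The degree in $t$ puts each
$\varphi(x_i)$ into $B$. Unique factor shapes make it a monomial, and counting total degrees makes
it a scalar multiple of a variable (`exists_perm_of_prod_pow_mul`). Thus $\varphi$ is monomial on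
$B$, affine in $t$, and its constant term is central. Automorphisms of $B$ itself are handled by
extending them to $B[t]$.

For derivations, applying $D$ to $x_jx_i+x_ix_j=0$ and comparing coefficients shows that $x_i$
divides $D(x_i)$ (`exists_derivation_x_eq`). In characteristic zero, a locally nilpotent derivation
of a domain kills such an element (`IsLocallyNilpotentDerivation.map_eq_zero_of_eq_mul`). -/

/-- The operator `e_a ↦ ± e_{a + δᵢ}`, with the sign picked up by moving `xᵢ` past the `xⱼ`,
`j < i`. -/
def shift (k : Type*) [CommRing k] {n : ℕ} (i : Fin n) :
    Module.End k ((Fin n →₀ ℕ) →₀ k) :=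
  linearCombination k fun a => single (a + single i 1) ((-1) ^ ∑ j ∈ Finset.Iio i, a j)

lemma shift_single (i : Fin n) (a : Fin n →₀ ℕ) (c : k) :
    shift k i (single a c) = single (a + single i 1) (c * (-1) ^ ∑ j ∈ Finset.Iio i, a j) := by
  simp [shift]

/-- Raising the exponent at `j` does not change the count below `i`, while raising the one at `i`
adds one to the count below `j`. The two composites therefore differ by exactly one sign. -/
lemma shift_anticomm {i j : Fin n} (h : i < j) : shift k i * shift k j + shift k j * shift k i = 0 := by
  refine lhom_ext fun a c => ?_
  have h1 : ∑ l ∈ Finset.Iio i, (a + single j 1 : Fin n →₀ ℕ) l = ∑ l ∈ Finset.Iio i, a l := by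
    refine Finset.sum_congr rfl fun l hl => ?_
    have : l ≠ j := ((Finset.mem_Iio.1 hl).trans h).ne
    simp [this.symm]
  have h2 : ∑ l ∈ Finset.Iio j, (a + single i 1 : Fin n →₀ ℕ) l = ∑ l ∈ Finset.Iio j, a l + 1 := by
    simp only [Finsupp.add_apply, Finset.sum_add_distrib, add_right_inj]
    rw [Finset.sum_eq_single i] <;> simp +contextual [h, eq_comm]
  simp only [LinearMap.add_apply, Module.End.mul_apply, shift_single, h1, h2]
  rw [add_right_comm a (single i 1), ← single_add, LinearMap.zero_apply, single_eq_zero, pow_succ]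
  ring

/-- The representation of `k₋₁[x₁, …, xₙ]` on the free module on the exponents. -/
def rep (k : Type*) [CommRing k] (n : ℕ) :
    SkewPoly k n →ₐ[k] Module.End k ((Fin n →₀ ℕ) →₀ k) :=
  RingQuot.liftAlgHom k ⟨FreeAlgebra.lift k (shift k), by
    intro a b h
    induction h with
    | anticomm i j h => simpa using shift_anticomm h⟩

lemma rep_x (i : Fin n) : rep k n (x k n i) = shift k i := by
  simp [rep, x]

lemma adjoin_range_x : Algebra.adjoin k (Set.range (x k n)) = ⊤ := by
  have h := congrArg (Subalgebra.map (RingQuot.mkAlgHom k (SkewRel k n)))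
    (FreeAlgebra.adjoin_range_ι k (Fin n))
  rw [AlgHom.map_adjoin, ← Set.range_comp, Algebra.map_top,
    (AlgHom.range_eq_top _).2 (RingQuot.mkAlgHom_surjective k _)] at h
  exact h

/-- The product of a word in the generators. -/
def word (k : Type*) [CommRing k] {n : ℕ} (l : List (Fin n)) : SkewPoly k n :=
  (l.map (x k n)).prod

/-- The exponent of the monomial given by a word. -/
def exponent (l : List (Fin n)) : Fin n →₀ ℕ := Multiset.toFinsupp (l : Multiset (Fin n))

lemma word_cons (i : Fin n) (l : List (Fin n)) : word k (i :: l) = x k n i * word k l := by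
  simp [word]

lemma exponent_cons (i : Fin n) (l : List (Fin n)) :
    exponent (i :: l) = single i 1 + exponent l := by
  rw [exponent, ← Multiset.cons_coe, ← Multiset.singleton_add, map_add,
    Multiset.toFinsupp_singleton, exponent]

lemma exists_exponent_eq (a : Fin n →₀ ℕ) : ∃ l, exponent l = a :=
  ⟨(Finsupp.toMultiset a).toList, by simp [exponent]⟩

lemma rep_word (l : List (Fin n)) (a : Fin n →₀ ℕ) :
    ∃ m : ℕ, rep k n (word k l) (single a 1) = single (exponent l + a) ((-1) ^ m) := by
  induction l with
  | nil => exact ⟨0, by simp [word, exponent]⟩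
  | cons i l ih =>
    obtain ⟨m, hm⟩ := ih
    refine ⟨m + ∑ j ∈ Finset.Iio i, (exponent l + a) j, ?_⟩
    rw [word_cons, map_mul, Module.End.mul_apply, hm, rep_x, shift_single, ← pow_add,
      exponent_cons, add_right_comm, add_comm (exponent l)]

lemma eq_neg_one_smul_of_add_eq_zero {A : Type*} [AddCommGroup A] [Module k A] {a b : A}
    (h : a + b = 0) : a = (-1 : k) • b := by
  rw [neg_one_smul]
  exact eq_neg_of_add_eq_zero_left h

lemma x_mul_x_of_ne {i j : Fin n} (h : i ≠ j) :
    x k n i * x k n j = (-1 : k) • (x k n j * x k n i) :=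
  eq_neg_one_smul_of_add_eq_zero (x_anticomm h)

lemma x_mul_x (i j : Fin n) : ∃ m : ℕ, x k n i * x k n j = (-1 : k) ^ m • (x k n j * x k n i) := by
  by_cases h : i = j
  · exact ⟨0, by simp [h]⟩
  · exact ⟨1, by rw [pow_one, x_mul_x_of_ne h]⟩

/-- Adjacent swaps generate all permutations, and each costs one sign, or none if the letters agree.
-/
lemma word_perm {l l' : List (Fin n)} (h : l.Perm l') :
    ∃ m : ℕ, word k l = (-1 : k) ^ m • word k l' := by
  induction h with
  | nil => exact ⟨0, by simp⟩
  | cons i _ ih =>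
    obtain ⟨m, hm⟩ := ih
    exact ⟨m, by rw [word_cons, word_cons, hm, mul_smul_comm]⟩
  | swap i j l =>
    obtain ⟨m, hm⟩ := x_mul_x (k := k) j i
    exact ⟨m, by simp only [word_cons, ← mul_assoc, hm, smul_mul_assoc]⟩
  | trans _ _ ih ih' =>
    obtain ⟨m, hm⟩ := ih
    obtain ⟨m', hm'⟩ := ih'
    exact ⟨m + m', by rw [hm, hm', smul_smul, pow_add]⟩

lemma word_eq_of_exponent_eq {l l' : List (Fin n)} (h : exponent l = exponent l') :
    ∃ m : ℕ, word k l = (-1 : k) ^ m • word k l' :=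
  word_perm (Multiset.coe_eq_coe.1 (Multiset.toFinsupp.injective h))

lemma span_range_word : Submodule.span k (Set.range (word k (n := n))) = ⊤ := by
  have h := congrArg Subalgebra.toSubmodule (adjoin_range_x (k := k) (n := n))
  rw [Algebra.adjoin_eq_span, Algebra.top_toSubmodule] at h
  rw [← top_le_iff, ← h]
  refine Submodule.span_mono fun b hb => ?_
  induction hb using Submonoid.closure_induction with
  | mem b hb =>
    obtain ⟨i, rfl⟩ := hb
    exact ⟨[i], by simp [word]⟩
  | one => exact ⟨[], by simp [word]⟩
  | mul b c _ _ hb hc =>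
    obtain ⟨l, rfl⟩ := hb
    obtain ⟨l', rfl⟩ := hc
    exact ⟨l ++ l', by simp [word]⟩

/-- The coordinates of an element with respect to the ordered monomials. -/
def expansion (k : Type*) [CommRing k] (n : ℕ) :
    SkewPoly k n →ₗ[k] ((Fin n →₀ ℕ) →₀ k) :=
  (LinearMap.applyₗ (single 0 1)).comp (rep k n).toLinearMap

lemma expansion_apply (b : SkewPoly k n) : expansion k n b = rep k n b (single 0 1) := rfl

lemma neg_one_pow_mul_self (m : ℕ) : (-1 : k) ^ m * (-1) ^ m = 1 := by
  rw [← pow_add, Even.neg_one_pow ⟨m, rfl⟩]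

/-- Choose one word for each exponent and let `ψ` send a basis vector to that word, with the sign
that makes `expansion` undo it. Since all words with the same exponent agree up to sign and words
span, `ψ` is onto, hence a two-sided inverse. -/
lemma expansion_bijective : Function.Bijective (expansion k n) := by
  choose w hw using exists_exponent_eq (n := n)
  choose s hs using fun a => rep_word (k := k) (w a) 0
  let ψ : ((Fin n →₀ ℕ) →₀ k) →ₗ[k] SkewPoly k n :=
    linearCombination k fun a => (-1 : k) ^ s a • word k (w a)
  have h1 : ∀ p, expansion k n (ψ p) = p := by
    intro p
    have : (expansion k n).comp ψ = LinearMap.id := by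
      refine lhom_ext fun a c => ?_
      simp only [ψ, LinearMap.comp_apply, linearCombination_single, map_smul, expansion_apply, hs,
        hw, add_zero, smul_single, smul_eq_mul, LinearMap.id_apply, neg_one_pow_mul_self, mul_one]
    exact LinearMap.congr_fun this p
  have h2 : Function.Surjective ψ := by
    rw [← LinearMap.range_eq_top, ← top_le_iff, ← span_range_word, Submodule.span_le]
    rintro _ ⟨l, rfl⟩
    obtain ⟨m, hm⟩ := word_eq_of_exponent_eq (k := k) (hw (exponent l)).symm
    refine ⟨single (exponent l) ((-1) ^ m * (-1) ^ s (exponent l)), ?_⟩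
    rw [hm]
    simp only [ψ, linearCombination_single, smul_smul, mul_assoc, neg_one_pow_mul_self, mul_one]
  refine ⟨fun b c h => ?_, fun p => ⟨ψ p, h1 p⟩⟩
  obtain ⟨p, rfl⟩ := h2 b
  obtain ⟨q, rfl⟩ := h2 c
  rw [h1, h1] at h
  rw [h]

/-- The basis of `k₋₁[x₁, …, xₙ]` consisting of the monomials `x₁^{a₁} ⋯ xₙ^{aₙ}`. -/
def mon (k : Type*) [CommRing k] (n : ℕ) : Module.Basis (Fin n →₀ ℕ) k (SkewPoly k n) :=
  ⟨LinearEquiv.ofBijective (expansion k n) expansion_bijective⟩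

lemma mon_repr_apply (b : SkewPoly k n) : (mon k n).repr b = rep k n b (single 0 1) := rfl

lemma mon_zero : mon k n 0 = 1 := by
  apply (mon k n).repr.injective
  rw [Module.Basis.repr_self, mon_repr_apply, map_one, Module.End.one_apply]

lemma mon_single (i : Fin n) : mon k n (single i 1) = x k n i := by
  apply (mon k n).repr.injective
  rw [Module.Basis.repr_self, mon_repr_apply, rep_x, shift_single]
  simp

lemma word_eq_mon (l : List (Fin n)) : ∃ m : ℕ, word k l = (-1 : k) ^ m • mon k n (exponent l) := by
  obtain ⟨m, hm⟩ := rep_word (k := k) l 0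
  refine ⟨m, (mon k n).repr.injective ?_⟩
  rw [mon_repr_apply, hm]
  simp

lemma mon_eq_word (l : List (Fin n)) : ∃ m : ℕ, mon k n (exponent l) = (-1 : k) ^ m • word k l := by
  obtain ⟨m, hm⟩ := word_eq_mon (k := k) l
  exact ⟨m, by rw [hm, smul_smul, neg_one_pow_mul_self, one_smul]⟩

lemma mon_mul_mon (a b : Fin n →₀ ℕ) :
    ∃ m : ℕ, mon k n a * mon k n b = (-1 : k) ^ m • mon k n (a + b) := by
  obtain ⟨l, rfl⟩ := exists_exponent_eq a
  obtain ⟨l', rfl⟩ := exists_exponent_eq b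
  obtain ⟨m, hm⟩ := mon_eq_word (k := k) l
  obtain ⟨m', hm'⟩ := mon_eq_word (k := k) l'
  obtain ⟨m₁, hm₁⟩ := word_eq_mon (k := k) (l ++ l')
  have h : exponent (l ++ l') = exponent l + exponent l' := by
    simp [exponent, ← Multiset.coe_add]
  refine ⟨m + m' + m₁, ?_⟩
  rw [hm, hm', smul_mul_smul_comm, show word k l * word k l' = word k (l ++ l') by simp [word], hm₁,
    h, smul_smul, pow_add, pow_add]

/-- One sign arises for each letter different from `i`. Length plus count has the same parity as
length minus count and avoids truncated subtraction. -/
lemma x_mul_word (i : Fin n) (l : List (Fin n)) :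
    x k n i * word k l = (-1 : k) ^ (l.length + l.count i) • (word k l * x k n i) := by
  induction l with
  | nil => simp [word]
  | cons j l ih =>
    rw [word_cons]
    by_cases h : i = j
    · subst h
      conv_lhs => rw [ih, mul_smul_comm]
      rw [mul_assoc, List.length_cons, List.count_cons_self, add_add_add_comm,
        pow_add _ _ (1 + 1), Even.neg_one_pow (n := 1 + 1) ⟨1, rfl⟩, mul_one]
    · rw [← mul_assoc, x_mul_x_of_ne h, smul_mul_assoc, mul_assoc, ih, mul_smul_comm, mul_assoc,
        List.length_cons, List.count_cons_of_ne (Ne.symm h), add_right_comm, pow_succ, mul_comm,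
        mul_smul]

lemma x_mul_mon (i : Fin n) (a : Fin n →₀ ℕ) :
    x k n i * mon k n a = (-1 : k) ^ (a.degree + a i) • (mon k n a * x k n i) := by
  obtain ⟨l, rfl⟩ := exists_exponent_eq a
  obtain ⟨m, hm⟩ := mon_eq_word (k := k) l
  have h1 : exponent l i = l.count i := by simp [exponent]
  have h2 : (exponent l).degree = l.length := by
    clear hm h1
    induction l with
    | nil => simp [exponent]
    | cons j l ih => rw [exponent_cons, map_add, ih, degree_single, List.length_cons, add_comm]
  rw [hm, mul_smul_comm, x_mul_word, smul_mul_assoc, smul_comm, h1, h2]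

lemma sum_mon (f : SkewPoly k n) :
    f = ∑ p ∈ ((mon k n).repr f).support, (mon k n).repr f p • mon k n p :=
  ((mon k n).linearCombination_repr f).symm

/-- The function `s` records the signs of products of basis monomials. Its values are irrelevant
later; only nonvanishing of single terms is used. -/
lemma repr_mul (f g : SkewPoly k n) (c : Fin n →₀ ℕ) : ∃ s : (Fin n →₀ ℕ) → (Fin n →₀ ℕ) → ℕ,
    (mon k n).repr (f * g) c = ∑ p ∈ ((mon k n).repr f).support, ∑ q ∈ ((mon k n).repr g).support,
      if p + q = c then (-1) ^ s p q * ((mon k n).repr f p * (mon k n).repr g q) else 0 := by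
  choose s hs using mon_mul_mon (k := k) (n := n)
  refine ⟨s, ?_⟩
  conv_lhs => rw [sum_mon f, sum_mon g]
  rw [Finset.sum_mul_sum]
  simp only [map_sum, smul_mul_smul_comm, hs, map_smul, Module.Basis.repr_self, smul_single,
    smul_eq_mul, mul_one, finsetSum_apply, single_apply]
  refine Finset.sum_congr rfl fun p _ => Finset.sum_congr rfl fun q _ => ?_
  split_ifs <;> ring

/-- The coefficient of a product at an exponent that arises in only one way. -/
lemma repr_mul_of_unique (f g : SkewPoly k n) (p q : Fin n →₀ ℕ)
    (h : ∀ p' ∈ ((mon k n).repr f).support, ∀ q' ∈ ((mon k n).repr g).support,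
      p' + q' = p + q → p' = p ∧ q' = q) :
    ∃ m : ℕ, (mon k n).repr (f * g) (p + q) =
      (-1) ^ m * ((mon k n).repr f p * (mon k n).repr g q) := by
  obtain ⟨s, hs⟩ := repr_mul f g (p + q)
  refine ⟨s p q, ?_⟩
  rw [hs, Finset.sum_eq_single p, Finset.sum_eq_single q, if_pos rfl]
  · intro q' _ hq'
    rw [if_neg fun e => hq' (add_left_cancel e)]
  · intro hq
    rw [notMem_support_iff.1 hq]
    simp
  · intro p' hp' hne
    refine Finset.sum_eq_zero fun q' hq' => if_neg fun e => hne (h p' hp' q' hq' e).1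
  · intro hp
    rw [notMem_support_iff.1 hp]
    simp

lemma repr_mul_eq_zero (f g : SkewPoly k n) (c : Fin n →₀ ℕ)
    (h : ∀ p ∈ ((mon k n).repr f).support, ∀ q ∈ ((mon k n).repr g).support, p + q ≠ c) :
    (mon k n).repr (f * g) c = 0 := by
  obtain ⟨s, hs⟩ := repr_mul f g c
  rw [hs]
  exact Finset.sum_eq_zero fun p hp => Finset.sum_eq_zero fun q hq => if_neg (h p hp q hq)

end DiscAut.SkewPoly
end

noncomputable section
namespace DiscAut.SkewPoly
open Finsupp

section CommRing
variable {k : Type*} [CommRing k] {n : ℕ}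

instance : Module.Free k (SkewPoly k n) := Module.Free.of_basis (mon k n)

instance [Nontrivial k] : Nontrivial (SkewPoly k n) := (mon k n).repr.toEquiv.nontrivial

lemma smul_one_injective : Function.Injective fun c : k => c • (1 : SkewPoly k n) := by
  intro c d h
  have := congrArg (fun f => (mon k n).repr f 0) h
  simpa [← mon_zero] using this

/-! ### The degree filtration -/

lemma mem_stdFiltration_iff {m : ℕ} {f : SkewPoly k n} :
    f ∈ (stdFiltration k (x k n)).F m ↔ ∀ p ∈ ((mon k n).repr f).support, p.degree ≤ m := by
  constructor
  -- `G` is the filtration by total degree of the support. It is multiplicative and contains the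
  -- generating pieces, so it contains the standard filtration by induction.
  · let G : ℕ → Submodule k (SkewPoly k n) := fun m =>
      (supported k k {p : Fin n →₀ ℕ | p.degree ≤ m}).comap (mon k n).repr.toLinearMap
    have hG : ∀ m f, f ∈ G m ↔ ∀ p ∈ ((mon k n).repr f).support, p.degree ≤ m := fun m f => Iff.rfl
    have hmul : ∀ i j, G i * G j ≤ G (i + j) := by
      intro i j
      rw [Submodule.mul_le]
      intro f hf g hg
      rw [hG] at *
      intro c hc
      by_contra! hlt
      refine mem_support_iff.1 hc (repr_mul_eq_zero f g c fun p hp q hq h => ?_)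
      have := hf p hp
      have := hg q hq
      rw [← h, map_add] at hlt
      omega
    have hone : (1 : Submodule k (SkewPoly k n)) ≤ G 0 := by
      rw [Submodule.one_le, hG, ← mon_zero]
      intro p hp
      by_contra h
      have h' : p ≠ 0 := fun e => h (by simp [e])
      simp [Ne.symm h'] at hp
    have hY : Submodule.span k (Set.range (x k n)) ≤ G 1 := by
      rw [Submodule.span_le]
      rintro _ ⟨i, rfl⟩
      rw [SetLike.mem_coe, hG, ← mon_single]
      intro p hp
      have : p = single i 1 := by
        by_contra h
        simp [Ne.symm h] at hp
      simp [this]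
    have hle : ∀ m, (stdFiltration k (x k n)).F m ≤ G m := by
      intro m
      induction m with
      | zero => simpa [stdFiltration] using hone
      | succ m ih =>
        refine (le_of_eq (pow_succ _ m)).trans ((mul_le_mul' ih (sup_le ?_ hY)).trans (hmul m 1))
        refine hone.trans fun f hf => (hG 1 f).2 fun p hp => ?_
        exact ((hG 0 f).1 hf p hp).trans zero_le_one
    exact fun hf => hle m hf
  · intro h
    rw [sum_mon f]
    refine Submodule.sum_mem _ fun p hp => Submodule.smul_mem _ _ ?_
    refine (stdFiltration k (x k n)).mono (h p hp) ?_
    obtain ⟨l, rfl⟩ := exists_exponent_eq p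
    obtain ⟨s, hs⟩ := mon_eq_word (k := k) l
    rw [hs]
    refine Submodule.smul_mem _ _ ?_
    clear hs hp h
    induction l with
    | nil => simpa [word, exponent] using (stdFiltration k (x k n)).one_mem
    | cons i l ih =>
      rw [word_cons, exponent_cons, map_add, degree_single]
      refine (stdFiltration k (x k n)).mul_mem ?_ ih
      refine (pow_one (1 ⊔ Submodule.span k (Set.range (x k n)))).symm.le ?_
      exact Submodule.mem_sup_right (Submodule.subset_span ⟨i, rfl⟩)

lemma stdFiltration_isExhaustive : (stdFiltration k (x k n)).IsExhaustive := fun f =>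
  ⟨((mon k n).repr f).support.sup Finsupp.degree,
    mem_stdFiltration_iff.2 fun _ hp => Finset.le_sup (f := Finsupp.degree) hp⟩

lemma exists_degree_eq_of_notMem_lt {m : ℕ} {f : SkewPoly k n}
    (hf : f ∈ (stdFiltration k (x k n)).F m) (hf' : f ∉ (stdFiltration k (x k n)).lt m) :
    ∃ p ∈ ((mon k n).repr f).support, p.degree = m := by
  rw [mem_stdFiltration_iff] at hf
  by_contra! h
  apply hf'
  cases m with
  | zero =>
    have : ((mon k n).repr f).support = ∅ :=
      Finset.eq_empty_of_forall_notMem fun p hp => h p hp (Nat.le_zero.1 (hf p hp))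
    rw [support_eq_empty, LinearEquiv.map_eq_zero_iff] at this
    exact (Submodule.mem_bot k).2 this
  | succ m =>
    exact mem_stdFiltration_iff.2 fun p hp =>
      Nat.le_of_lt_succ (lt_of_le_of_ne (hf p hp) (h p hp))

lemma notMem_lt_of_degree_eq {m : ℕ} {f : SkewPoly k n} {p : Fin n →₀ ℕ}
    (hp : p ∈ ((mon k n).repr f).support) (h : p.degree = m) :
    f ∉ (stdFiltration k (x k n)).lt m := by
  cases m with
  | zero =>
    intro hf
    have : f = 0 := (Submodule.mem_bot k).1 hf
    simp [this] at hp
  | succ m =>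
    intro hf
    have := mem_stdFiltration_iff.1 hf p hp
    omega

/-! ### Monomials -/

/-- `f` is a nonzero scalar multiple of the monomial with exponent `p`. -/
def IsMonomial (f : SkewPoly k n) (p : Fin n →₀ ℕ) : Prop :=
  ((mon k n).repr f).support = {p}

lemma isMonomial_iff {f : SkewPoly k n} {p : Fin n →₀ ℕ} :
    IsMonomial f p ↔ ∃ r : k, r ≠ 0 ∧ f = r • mon k n p := by
  constructor
  · intro h
    rw [IsMonomial, support_eq_singleton] at h
    refine ⟨_, h.1, (mon k n).repr.injective ?_⟩
    rw [h.2]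
    simp
  · rintro ⟨r, hr, rfl⟩
    rw [IsMonomial, map_smul, Module.Basis.repr_self, smul_single, smul_eq_mul, mul_one,
      support_single _ hr]

lemma IsMonomial.ne_zero {f : SkewPoly k n} {p : Fin n →₀ ℕ} (h : IsMonomial f p) : f ≠ 0 := by
  rintro rfl
  simp [IsMonomial] at h

lemma IsMonomial.unique {f : SkewPoly k n} {p q : Fin n →₀ ℕ} (h : IsMonomial f p)
    (h' : IsMonomial f q) : p = q :=
  Finset.singleton_injective (h.symm.trans h')

end CommRing

/-! ### Zero divisors, factors of monomials, and units -/

variable {k : Type*} [CommRing k] [IsDomain k] {n : ℕ}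

lemma repr_mul_ne_zero_of_unique {f g : SkewPoly k n} {p q : Fin n →₀ ℕ}
    (hp : p ∈ ((mon k n).repr f).support) (hq : q ∈ ((mon k n).repr g).support)
    (h : ∀ p' ∈ ((mon k n).repr f).support, ∀ q' ∈ ((mon k n).repr g).support,
      p' + q' = p + q → p' = p ∧ q' = q) :
    p + q ∈ ((mon k n).repr (f * g)).support := by
  obtain ⟨m, hm⟩ := repr_mul_of_unique f g p q h
  rw [mem_support_iff] at *
  rw [hm]
  exact mul_ne_zero (pow_ne_zero _ (neg_ne_zero.2 one_ne_zero)) (mul_ne_zero hp hq)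

/-- Unique sums are applied to the exponents of top degree only. By degree, any other pair with the
same sum would also consist of top exponents, so uniqueness holds in the full supports. -/
lemma mul_notMem_lt {i j : ℕ} {f g : SkewPoly k n}
    (hf : f ∈ (stdFiltration k (x k n)).F i) (hf' : f ∉ (stdFiltration k (x k n)).lt i)
    (hg : g ∈ (stdFiltration k (x k n)).F j) (hg' : g ∉ (stdFiltration k (x k n)).lt j) :
    f * g ∉ (stdFiltration k (x k n)).lt (i + j) := by
  obtain ⟨p₀, hp₀, hpi⟩ := exists_degree_eq_of_notMem_lt hf hf'
  obtain ⟨q₀, hq₀, hqj⟩ := exists_degree_eq_of_notMem_lt hg hg'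
  rw [mem_stdFiltration_iff] at hf hg
  obtain ⟨p, hp, q, hq, hu⟩ := UniqueSums.uniqueAdd_of_nonempty
    (A := ((mon k n).repr f).support.filter fun p => p.degree = i)
    (B := ((mon k n).repr g).support.filter fun p => p.degree = j)
    ⟨p₀, by simp_all⟩ ⟨q₀, by simp_all⟩
  rw [Finset.mem_filter] at hp hq
  refine notMem_lt_of_degree_eq (p := p + q) (repr_mul_ne_zero_of_unique hp.1 hq.1 ?_)
    (by rw [map_add, hp.2, hq.2])
  intro p' hp' q' hq' h
  have h1 := hf p' hp'
  have h2 := hg q' hq'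
  have h3 := congrArg Finsupp.degree h
  rw [map_add, map_add] at h3
  exact hu (Finset.mem_filter.2 ⟨hp', by omega⟩) (Finset.mem_filter.2 ⟨hq', by omega⟩) h

instance : NoZeroDivisors (SkewPoly k n) where
  eq_zero_or_eq_zero_of_mul_eq_zero {f g} h := by
    by_contra! hne
    obtain ⟨p, hp, q, hq, hu⟩ := UniqueSums.uniqueAdd_of_nonempty
      (A := ((mon k n).repr f).support) (B := ((mon k n).repr g).support)
      (by simpa [support_nonempty_iff] using hne.1) (by simpa [support_nonempty_iff] using hne.2)
    have := repr_mul_ne_zero_of_unique hp hq fun p' hp' q' hq' h => hu hp' hq' h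
    simp [h] at this

lemma isMonomial_mon (p : Fin n →₀ ℕ) : IsMonomial (mon k n p) p :=
  isMonomial_iff.2 ⟨1, one_ne_zero, (one_smul k _).symm⟩

lemma isMonomial_one : IsMonomial (1 : SkewPoly k n) 0 := by
  rw [← mon_zero]
  exact isMonomial_mon 0

lemma isMonomial_x (i : Fin n) : IsMonomial (x k n i) (single i 1) := by
  rw [← mon_single]
  exact isMonomial_mon _

lemma IsMonomial.mul {f g : SkewPoly k n} {p q : Fin n →₀ ℕ} (hf : IsMonomial f p)
    (hg : IsMonomial g q) : IsMonomial (f * g) (p + q) := by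
  rw [isMonomial_iff] at *
  obtain ⟨r, hr, rfl⟩ := hf
  obtain ⟨s, hs, rfl⟩ := hg
  obtain ⟨m, hm⟩ := mon_mul_mon (k := k) p q
  refine ⟨r * s * (-1) ^ m, ?_, by rw [smul_mul_smul_comm, hm, smul_smul]⟩
  exact mul_ne_zero (mul_ne_zero hr hs) (pow_ne_zero _ (neg_ne_zero.2 one_ne_zero))

/-- If one of the supports had more than one element, two different pairs of exponents would have
unique sums. Both sums would survive in the product, which has only one exponent. -/
lemma IsMonomial.of_mul {f g : SkewPoly k n} {c : Fin n →₀ ℕ} (h : IsMonomial (f * g) c) :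
    ∃ p q, p + q = c ∧ IsMonomial f p ∧ IsMonomial g q := by
  have hf : f ≠ 0 := fun e => h.ne_zero (by rw [e, zero_mul])
  have hg : g ≠ 0 := fun e => h.ne_zero (by rw [e, mul_zero])
  have hA : 0 < ((mon k n).repr f).support.card := by
    rw [Finset.card_pos, support_nonempty_iff]; simpa using hf
  have hB : 0 < ((mon k n).repr g).support.card := by
    rw [Finset.card_pos, support_nonempty_iff]; simpa using hg
  by_cases hc : 1 < ((mon k n).repr f).support.card * ((mon k n).repr g).support.card
  · obtain ⟨⟨p, q⟩, h₁, ⟨p', q'⟩, h₂, hne, hu₁, hu₂⟩ := TwoUniqueSums.uniqueAdd_of_one_lt_card hc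
    rw [Finset.mem_product] at h₁ h₂
    have h₁' := repr_mul_ne_zero_of_unique h₁.1 h₁.2 fun _ ha _ hb h => hu₁ ha hb h
    have h₂' := repr_mul_ne_zero_of_unique h₂.1 h₂.2 fun _ ha _ hb h => hu₂ ha hb h
    rw [h, Finset.mem_singleton] at h₁' h₂'
    obtain ⟨e, e'⟩ := hu₁ h₂.1 h₂.2 (h₂'.trans h₁'.symm)
    exact (hne (Prod.ext e.symm e'.symm)).elim
  · obtain ⟨hA', hB'⟩ : ((mon k n).repr f).support.card = 1 ∧ ((mon k n).repr g).support.card = 1 :=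
      mul_eq_one.1 (le_antisymm (not_lt.1 hc) (Nat.mul_pos hA hB))
    obtain ⟨p, hp⟩ := Finset.card_eq_one.1 hA'
    obtain ⟨q, hq⟩ := Finset.card_eq_one.1 hB'
    exact ⟨p, q, (IsMonomial.mul hp hq).unique h, hp, hq⟩

lemma IsMonomial.pow {f : SkewPoly k n} {p : Fin n →₀ ℕ} (hf : IsMonomial f p) (m : ℕ) :
    IsMonomial (f ^ m) (m • p) := by
  induction m with
  | zero => simpa using isMonomial_one
  | succ m ih => rw [pow_succ, succ_nsmul]; exact ih.mul hf

/-- A unit of the skew polynomial ring is a unit of the base ring. -/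
lemma exists_unit_of_mul_eq_one {f g : SkewPoly k n} (h : f * g = 1) :
    ∃ c : kˣ, f = (c : k) • (1 : SkewPoly k n) := by
  obtain ⟨p, q, hpq, hf, hg⟩ := IsMonomial.of_mul (h ▸ isMonomial_one : IsMonomial (f * g) 0)
  obtain ⟨rfl, rfl⟩ := add_eq_zero.1 hpq
  obtain ⟨r, -, rfl⟩ := isMonomial_iff.1 hf
  obtain ⟨s, -, rfl⟩ := isMonomial_iff.1 hg
  rw [mon_zero, smul_mul_smul_comm, one_mul] at h
  have : r * s = 1 := smul_one_injective (h.trans (one_smul k 1).symm)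
  exact ⟨Units.mkOfMulEqOne r s this, by rw [mon_zero, Units.val_mkOfMulEqOne]⟩

end DiscAut.SkewPoly
end

noncomputable section
namespace DiscAut

/-! ### Additivity of degrees in filtered algebras, and dominating monomials -/

namespace AlgFiltration
variable {k T : Type*} [CommRing k] [Ring T] [Algebra k T] (Φ : AlgFiltration k T)

lemma cls_eq_zero_iff {i : ℕ} {a : T} (ha : a ∈ Φ.F i) : Φ.cls a ha = 0 ↔ a ∈ Φ.lt i :=
  (Submodule.Quotient.mk_eq_zero _).trans Iff.rfl

/-- `a` is homogeneous of degree exactly `i` up to terms of lower degree. -/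
def HasDeg (a : T) (i : ℕ) : Prop := a ∈ Φ.F i ∧ a ∉ Φ.lt i

variable {Φ}

lemma HasDeg.deg_eq {a : T} {i : ℕ} (h : Φ.HasDeg a i) : Φ.deg a = i := by
  refine le_antisymm (Nat.sInf_le h.1) (le_csInf ⟨i, h.1⟩ fun j hj => ?_)
  by_contra! hlt
  obtain ⟨i, rfl⟩ := Nat.exists_eq_succ_of_ne_zero (Nat.ne_zero_of_lt hlt)
  exact h.2 (Φ.mono (Nat.le_of_lt_succ hlt) hj)

lemma IsExhaustive.hasDeg (h : Φ.IsExhaustive) {a : T} (ha : a ≠ 0) : Φ.HasDeg a (Φ.deg a) := by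
  refine ⟨Nat.sInf_mem (h a), fun h' => ?_⟩
  cases hd : Φ.deg a with
  | zero =>
    rw [hd] at h'
    exact ha ((Submodule.mem_bot k).1 h')
  | succ i =>
    rw [hd] at h'
    have : Φ.deg a ≤ i := Nat.sInf_le h'
    omega

lemma HasDeg.mul (hΦ : IsDomain (⨁ n, Φ.gr n)) {a b : T} {i j : ℕ} (ha : Φ.HasDeg a i)
    (hb : Φ.HasDeg b j) : Φ.HasDeg (a * b) (i + j) := by
  refine ⟨Φ.mul_mem ha.1 hb.1, fun h => ?_⟩
  rw [← Φ.cls_eq_zero_iff (Φ.mul_mem ha.1 hb.1)] at h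
  have h' : DirectSum.of Φ.gr i (Φ.cls a ha.1) * DirectSum.of Φ.gr j (Φ.cls b hb.1) = 0 := by
    rw [DirectSum.of_mul_of]
    change DirectSum.of Φ.gr (i + j) (Φ.cls (a * b) _) = 0
    rw [h, map_zero]
  rcases mul_eq_zero.1 h' with h' | h'
  · exact ha.2 ((Φ.cls_eq_zero_iff _).1 (DirectSum.of_injective i (h'.trans (map_zero _).symm)))
  · exact hb.2 ((Φ.cls_eq_zero_iff _).1 (DirectSum.of_injective j (h'.trans (map_zero _).symm)))

lemma hasDeg_one (hΦ : IsDomain (⨁ n, Φ.gr n)) : Φ.HasDeg 1 0 := by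
  refine ⟨Φ.one_mem, fun h => ?_⟩
  have : (1 : ⨁ n, Φ.gr n) = 0 := by
    change DirectSum.of Φ.gr 0 (Φ.cls 1 Φ.one_mem) = 0
    rw [(Φ.cls_eq_zero_iff _).2 h, map_zero]
  exact one_ne_zero this

lemma HasDeg.pow (hΦ : IsDomain (⨁ n, Φ.gr n)) {a : T} {i : ℕ} (ha : Φ.HasDeg a i) (m : ℕ) :
    Φ.HasDeg (a ^ m) (m * i) := by
  induction m with
  | zero => simpa using hasDeg_one hΦ
  | succ m ih => rw [pow_succ, Nat.succ_mul]; exact ih.mul hΦ ha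

lemma HasDeg.list_prod (hΦ : IsDomain (⨁ n, Φ.gr n)) {ι : Type*} {a : ι → T} {d : ι → ℕ}
    (h : ∀ i, Φ.HasDeg (a i) (d i)) (l : List ι) : Φ.HasDeg (l.map a).prod (l.map d).sum := by
  induction l with
  | nil => simpa using hasDeg_one hΦ
  | cons i l ih => simpa using (h i).mul hΦ ih

/-- The associated graded ring is a domain as soon as degrees are additive. -/
lemma isDomain_gr [Nontrivial T]
    (h : ∀ {a b : T} {i j : ℕ}, Φ.HasDeg a i → Φ.HasDeg b j → a * b ∉ Φ.lt (i + j)) :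
    IsDomain (⨁ n, Φ.gr n) := by
  classical
  have h0 : NoZeroDivisors (⨁ n, Φ.gr n) := by
    refine ⟨fun {x y} hxy => ?_⟩
    by_contra! hne
    have hx : (DFinsupp.support x).Nonempty := by
      rw [Finset.nonempty_iff_ne_empty, Ne, DFinsupp.support_eq_empty]; exact hne.1
    have hy : (DFinsupp.support y).Nonempty := by
      rw [Finset.nonempty_iff_ne_empty, Ne, DFinsupp.support_eq_empty]; exact hne.2
    set i := (DFinsupp.support x).max' hx
    set j := (DFinsupp.support y).max' hy
    have hix : x i ≠ 0 := DFinsupp.mem_support_iff.1 (Finset.max'_mem _ hx)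
    have hjy : y j ≠ 0 := DFinsupp.mem_support_iff.1 (Finset.max'_mem _ hy)
    -- By maximality of `i` and `j`, no other pair of components reaches degree `i + j`.
    have key : (x * y) (i + j) = GradedMonoid.GMul.mul (x i) (y j) := by
      rw [DirectSum.mul_eq_sum_support_ghas_mul, DirectSum.sum_apply,
        Finset.sum_eq_single (i, j)]
      · exact DirectSum.of_eq_same _ _
      · rintro ⟨i', j'⟩ hmem hne'
        rw [Finset.mem_product] at hmem
        have h1 : i' ≤ i := Finset.le_max' _ _ hmem.1
        have h2 : j' ≤ j := Finset.le_max' _ _ hmem.2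
        refine DirectSum.of_eq_of_ne _ _ _ fun e => hne' ?_
        simp only [Prod.mk.injEq]
        simp only at e
        omega
      · intro hmem
        exact (hmem (Finset.mem_product.2 ⟨Finset.max'_mem _ hx, Finset.max'_mem _ hy⟩)).elim
    obtain ⟨a, ha, hax⟩ := Φ.exists_cls (x i)
    obtain ⟨b, hb, hby⟩ := Φ.exists_cls (y j)
    rw [hxy, hax, hby] at key
    rw [hax, Ne, cls_eq_zero_iff] at hix
    rw [hby, Ne, cls_eq_zero_iff] at hjy
    exact h ⟨ha, hix⟩ ⟨hb, hjy⟩ ((Φ.cls_eq_zero_iff (Φ.mul_mem ha hb)).1 key.symm)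
  have h1 : Nontrivial (⨁ n, Φ.gr n) := by
    refine ⟨DirectSum.of Φ.gr 0 (Φ.cls 1 Φ.one_mem), 0, fun e => ?_⟩
    have := (Φ.cls_eq_zero_iff _).1 (DirectSum.of_injective 0 (e.trans (map_zero _).symm))
    exact one_ne_zero ((Submodule.mem_bot k).1 this)
  -- The graded structure supplies only a semiring; negation comes from the `k`-module structure.
  let _ : Ring (⨁ n, Φ.gr n) :=
    { (inferInstance : Semiring (⨁ n, Φ.gr n)),
      Module.addCommMonoidToAddCommGroup k (M := ⨁ n, Φ.gr n) with }
  exact NoZeroDivisors.to_isDomain (⨁ n, Φ.gr n)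

end AlgFiltration

open AlgFiltration in
/-- An ordered monomial in which all the generators occur is dominating. -/
lemma isDominating_of_eq_prod.{u₁, v₁, w₁} {k : Type u₁} {A : Type v₁} [CommRing k] [Nontrivial k]
    [Ring A] [Algebra k A] {m : ℕ} {x : Fin m → A} {e : Fin m → ℕ} (he : ∀ i, 0 < e i) {f : A}
    (hf : ((List.finRange m).map fun i => x i ^ e i).prod = f) (hf0 : f ≠ 0) :
    IsDominating.{u₁, v₁, w₁} k x f := by
  refine ⟨hf0, fun T _ _ Ψ _ hex hgr y hy => ?_⟩
  -- The lift is the same ordered word in free variables, so its value at `y` has degree $\sum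
  -- e_i\deg y_i$.
  refine ⟨((List.finRange m).map fun i => FreeAlgebra.ι k i ^ e i).prod, ?_, Or.inr ?_⟩
  · rw [← hf, map_list_prod, List.map_map]
    simp [Function.comp_def]
  have hdeg : ∀ l : List (Fin m), (l.map fun i => x i ^ e i).prod ∈
      (stdFiltration k x).F (l.map e).sum := by
    intro l
    induction l with
    | nil => simpa using (stdFiltration k x).one_mem
    | cons i l ih =>
      simp only [List.map_cons, List.prod_cons, List.sum_cons]
      refine (stdFiltration k x).mul_mem ?_ ih
      exact Submodule.pow_mem_pow _ (Submodule.mem_sup_right (Submodule.subset_span (Set.mem_range_self i))) _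
  have h1 : (stdFiltration k x).deg f ≤ ∑ i, e i := by
    refine Nat.sInf_le ?_
    have := hdeg (List.finRange m)
    rw [hf] at this
    rwa [← List.ofFn_eq_map, List.sum_ofFn] at this
  -- Independence modulo `Ψ.F 0` keeps each `y i` out of `Ψ.F 0`, so its degree is at least one.
  have hy0 : ∀ i, y i ∉ Ψ.F 0 := fun i h => hy.ne_zero i (by simpa using h)
  have hyd : ∀ i, Ψ.HasDeg (y i) (Ψ.deg (y i)) := fun i =>
    hex.hasDeg fun h => hy0 i (h ▸ zero_mem _)
  have hpos : ∀ i, 1 ≤ Ψ.deg (y i) := fun i => by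
    by_contra! h
    have := (hyd i).1
    rw [Nat.lt_one_iff.1 h] at this
    exact hy0 i this
  have h2 : Ψ.deg (FreeAlgebra.lift k y ((List.finRange m).map fun i => FreeAlgebra.ι k i ^ e i).prod)
      = ∑ i, e i * Ψ.deg (y i) := by
    rw [map_list_prod, List.map_map, ← List.sum_ofFn, List.ofFn_eq_map]
    simp only [Function.comp_def, map_pow, FreeAlgebra.lift_ι_apply]
    exact (HasDeg.list_prod hgr.1 (fun i => (hyd i).pow hgr.1 (e i)) _).deg_eq
  rw [h2]
  refine ⟨h1.trans (Finset.sum_le_sum fun i _ => Nat.le_mul_of_pos_right _ (hpos i)), ?_⟩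
  rintro ⟨i, hi⟩
  refine h1.trans_lt (Finset.sum_lt_sum (fun i _ => Nat.le_mul_of_pos_right _ (hpos i))
    ⟨i, Finset.mem_univ i, ?_⟩)
  exact lt_mul_of_one_lt_right (he i) hi

namespace SkewPoly

lemma isConnectedGradedDomain {k : Type*} [CommRing k] [IsDomain k] {n : ℕ} :
    (stdFiltration k (x k n)).IsConnectedGradedDomain := by
  refine ⟨AlgFiltration.isDomain_gr fun ha hb => mul_notMem_lt ha.1 ha.2 hb.1 hb.2, ?_, ?_⟩
  · intro c d h
    have h' := Submodule.quotientRel_def _ |>.1 (Quotient.exact h)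
    have h'' : algebraMap k (SkewPoly k n) c - algebraMap k (SkewPoly k n) d = 0 := h'
    rw [sub_eq_zero, Algebra.algebraMap_eq_smul_one, Algebra.algebraMap_eq_smul_one] at h''
    exact smul_one_injective h''
  · intro y
    obtain ⟨a, ha, rfl⟩ := AlgFiltration.exists_cls _ y
    have ha' : a ∈ (1 : Submodule k (SkewPoly k n)) := by
      rw [← pow_zero (1 ⊔ Submodule.span k (Set.range (x k n)))]
      exact ha
    obtain ⟨c, rfl⟩ := Submodule.mem_one.1 ha'
    exact ⟨c, rfl⟩

end SkewPoly
end DiscAut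
end

noncomputable section
namespace DiscAut

/-! ### Discriminants of algebras with a monomial basis -/

section General
variable {R A ι : Type*} [CommRing R] [Ring A] [Algebra R A] [Fintype ι] [DecidableEq ι]

lemma regTrace_eq_sum (b : Module.Basis ι R A) (a : A) :
    regTrace R A a = ∑ i, b.repr (a * b i) i := by
  rw [regTrace, LinearMap.comp_apply, LinearMap.trace_eq_matrix_trace R b, Matrix.trace]
  simp [LinearMap.toMatrix_apply]

/-- A basis whose elements square to scalars and multiply, up to scalars, like the elements of an
elementary abelian `2`-group. -/
structure IsMonomialBasis (b : Module.Basis ι R A) (c : ι → R) : Prop where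
  mul_self : ∀ i, b i * b i = algebraMap R A (c i)
  mul_ne : ∀ i j, i ≠ j → ∀ l, ∃ m, m ≠ l ∧ ∃ z : R, b i * b j * b l = z • b m

variable {b : Module.Basis ι R A} {c : ι → R}

/-- The square of a basis element acts as a scalar. A product of two different ones moves every
basis vector to a multiple of another, so its matrix has zero diagonal. -/
lemma IsMonomialBasis.regTrace_mul_basis (h : IsMonomialBasis b c) (i j : ι) :
    regTrace R A (b i * b j) = if i = j then Fintype.card ι * c i else 0 := by
  rw [regTrace_eq_sum b]
  split_ifs with hij
  · subst hij
    simp [h.mul_self, ← Algebra.smul_def]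
  · refine Finset.sum_eq_zero fun l _ => ?_
    obtain ⟨m, hm, z, hz⟩ := h.mul_ne i j hij l
    rw [hz]
    simp [hm]

lemma IsMonomialBasis.regTrace_mul (h : IsMonomialBasis b c) (a a' : A) :
    regTrace R A (a * a') = ∑ i, b.repr a i * (Fintype.card ι * c i) * b.repr a' i := by
  conv_lhs => rw [← b.sum_repr a, ← b.sum_repr a']
  simp_rw [Finset.sum_mul_sum, smul_mul_smul_comm, map_sum, map_smul, h.regTrace_mul_basis,
    smul_eq_mul, mul_ite, mul_zero]
  refine Finset.sum_congr rfl fun i _ => ?_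
  rw [Finset.sum_ite_eq, if_pos (Finset.mem_univ i)]
  ring

/-- The Gram matrix of any family is $PGP^{T}$, with $P$ its coordinate matrix and $G$ the diagonal
Gram matrix of the basis. All determinants are thus multiples of $\det G$, which the basis itself
attains. -/
lemma IsMonomialBasis.discIdeal_card (h : IsMonomialBasis b c) :
    discIdeal R A (Fintype.card ι) = Ideal.span {∏ i, (Fintype.card ι * c i)} := by
  let e : Fin (Fintype.card ι) ≃ ι := (Fintype.equivFin ι).symm
  have hdet : ∀ z : Fin (Fintype.card ι) → A,
      (Matrix.of fun i j => regTrace R A (z i * z j)).det =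
        (Matrix.of fun i j => b.repr (z i) (e j)).det ^ 2 * ∏ i, (Fintype.card ι * c i) := by
    intro z
    set P : Matrix (Fin (Fintype.card ι)) (Fin (Fintype.card ι)) R :=
      Matrix.of fun i j => b.repr (z i) (e j) with hP
    have hM : (Matrix.of fun i j => regTrace R A (z i * z j)) =
        P * Matrix.diagonal (fun i => Fintype.card ι * c (e i)) * P.transpose := by
      ext i j
      rw [Matrix.mul_apply, Matrix.of_apply, h.regTrace_mul, ← e.sum_comp]
      simp [hP, Matrix.mul_diagonal]
    rw [hM, Matrix.det_mul, Matrix.det_mul, Matrix.det_transpose, Matrix.det_diagonal,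
      e.prod_comp fun i => (Fintype.card ι * c i : R)]
    ring
  apply le_antisymm
  · rw [discIdeal, Ideal.span_le]
    rintro _ ⟨z, rfl⟩
    exact Ideal.mem_span_singleton'.2 ⟨_, (hdet z).symm⟩
  · rw [discIdeal, Ideal.span_singleton_le_iff_mem]
    refine Ideal.subset_span ⟨fun i => b (e i), (hdet _).trans ?_⟩
    have : (Matrix.of fun i j => b.repr (b (e i)) (e j)) = 1 := by
      ext i j
      simp [Finsupp.single_apply, Matrix.one_apply]
    rw [this, Matrix.det_one, one_pow, one_mul]

lemma IsMonomialBasis.discIdeal_finrank [Nontrivial R] (h : IsMonomialBasis b c)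
    (hcard : IsUnit (Fintype.card ι : R)) :
    discIdeal R A (Module.finrank R A) = Ideal.span {∏ i, c i} := by
  rw [Module.finrank_eq_card_basis b, h.discIdeal_card, Finset.prod_mul_distrib,
    Ideal.span_singleton_mul_left_unit]
  rw [Finset.prod_const]
  exact hcard.pow _

end General

/-- The image of the discriminant of `A` over its center under an automorphism divides it. -/
lemma IsMonomialBasis.exists_map_mul_eq {A ι : Type*} [Ring A] [Nontrivial A] [Fintype ι]
    [DecidableEq ι] {b : Module.Basis ι (Subring.center A) A} {c : ι → Subring.center A}
    (h : IsMonomialBasis b c) (hcard : IsUnit (Fintype.card ι : Subring.center A))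
    (φ : A ≃+* A) : ∃ z : A, φ ((∏ i, c i : Subring.center A) : A) * z =
      ((∏ i, c i : Subring.center A) : A) := by
  let ψ : Subring.center A ≃+* Subring.center A := Subring.centerCongr φ
  have hψ : ∀ z : Subring.center A, ((ψ z : Subring.center A) : A) = φ z := fun z => rfl
  have hsmul : ∀ (z : Subring.center A) (a : A), φ (z • a) = ψ z • φ a := fun z a => map_mul φ _ _
  -- `φ` is semilinear over the automorphism `ψ` of the center, so it carries the monomial basis to
  -- another one.
  let b' : Module.Basis ι (Subring.center A) A := Module.Basis.mk (v := fun i => φ (b i))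
    (b.linearIndependent.map_of_surjective_injective ψ φ.toAddMonoidHom
      ψ.surjective (fun a ha => by simpa using ha) hsmul) (by
    intro a _
    rw [← φ.apply_symm_apply a, ← b.sum_repr (φ.symm a), map_sum]
    refine Submodule.sum_mem _ fun i _ => ?_
    rw [hsmul]
    exact Submodule.smul_mem _ _ (Submodule.subset_span ⟨i, rfl⟩))
  have hb' : ∀ i, b' i = φ (b i) := fun i => Module.Basis.mk_apply _ _ i
  have h' : IsMonomialBasis b' fun i => ψ (c i) := by
    constructor
    · intro i
      rw [hb', ← map_mul, h.mul_self]
      rfl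
    · intro i j hij l
      obtain ⟨m, hm, z, hz⟩ := h.mul_ne i j hij l
      exact ⟨m, hm, ψ z, by simp only [hb']; rw [← map_mul, ← map_mul, hz, hsmul]⟩
  -- The discriminant ideal does not depend on the basis, so the generators computed from the two
  -- bases span the same ideal.
  have key := (h.discIdeal_finrank hcard).symm.trans (h'.discIdeal_finrank hcard)
  obtain ⟨z, hz⟩ := Ideal.mem_span_singleton'.1 (key ▸ Ideal.mem_span_singleton_self (∏ i, c i))
  refine ⟨z, ?_⟩
  rw [← hψ, map_prod, ← hz, mul_comm z]
  rfl

/-! ### Polynomial extensions -/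

section Polynomial
open Polynomial
variable {A : Type*} [Ring A]

/-- Commuting with constants is a condition on each coefficient; conversely, the variable is already
central. -/
lemma mem_center_polynomial_iff {f : A[X]} :
    f ∈ Subring.center A[X] ↔ ∀ m, f.coeff m ∈ Subring.center A := by
  constructor
  · intro h m
    rw [Subring.mem_center_iff] at *
    intro a
    simpa using congrArg (coeff · m) (h (C a))
  · intro h
    rw [Subring.mem_center_iff]
    intro g
    ext m
    rw [coeff_mul, coeff_mul, ← Finset.Nat.sum_antidiagonal_swap]
    exact Finset.sum_congr rfl fun p _ => Subring.mem_center_iff.1 (h _) _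

/-- The inclusion of the center of `A` into the center of `A[X]`. -/
def centerC (A : Type*) [Ring A] : Subring.center A →+* Subring.center A[X] :=
  (C.comp (Subring.center A).subtype).codRestrict _ fun z => by
    rw [mem_center_polynomial_iff]
    intro m
    rw [RingHom.comp_apply, coeff_C]
    split_ifs
    · exact z.2
    · exact zero_mem _

lemma coe_centerC (z : Subring.center A) : (centerC A z : A[X]) = C (z : A) := rfl

variable {ι : Type*} [Fintype ι]

/-- A basis of `A` over its center is a basis of `A[X]` over its center. -/
def polynomialBasis (b : Module.Basis ι (Subring.center A) A) :
    Module.Basis ι (Subring.center A[X]) A[X] :=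
  Module.Basis.mk (v := fun i => C (b i))
    (by
      rw [Fintype.linearIndependent_iff]
      intro g hg i
      ext m
      have hg' := congrArg (coeff · m) hg
      simp only [finsetSum_coeff, coeff_zero] at hg'
      -- Each coefficient of a relation over the center of `A[X]` is a relation over the center of
      -- `A`.
      have h0 : ∑ i, (⟨(g i : A[X]).coeff m, mem_center_polynomial_iff.1 (g i).2 m⟩ :
          Subring.center A) • b i = 0 := by
        rw [← hg']
        refine Finset.sum_congr rfl fun i _ => ?_
        change (g i : A[X]).coeff m * b i = ((g i : A[X]) * C (b i)).coeff m
        rw [coeff_mul_C]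
      exact congrArg Subtype.val (Fintype.linearIndependent_iff.1 b.linearIndependent _ h0 i))
    (by
      intro f _
      induction f using Polynomial.induction_on' with
      | add f g hf hg => exact add_mem (hf trivial) (hg trivial)
      | monomial m a =>
        rw [← b.sum_repr a, map_sum]
        refine Submodule.sum_mem _ fun i _ => ?_
        have hX : (X ^ m : A[X]) ∈ Subring.center A[X] := by
          rw [Subring.mem_center_iff]
          intro g
          exact X_pow_mul.symm
        have : monomial m (b.repr a i • b i) =
            (centerC A (b.repr a i) * ⟨X ^ m, hX⟩ : Subring.center A[X]) • C (b i) := by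
          change monomial m ((b.repr a i : A) * b i) = (C (b.repr a i : A) * X ^ m) * C (b i)
          rw [← C_mul_X_pow_eq_monomial, C_mul, mul_assoc, mul_assoc, X_pow_mul]
        rw [this]
        exact Submodule.smul_mem _ _ (Submodule.subset_span ⟨i, rfl⟩))

lemma polynomialBasis_apply (b : Module.Basis ι (Subring.center A) A) (i : ι) :
    polynomialBasis b i = C (b i) := by
  simp [polynomialBasis]

/-- Consequently the discriminant of `A[X]` over its center is generated by the constant polynomial
given by that of `A`. -/
lemma IsMonomialBasis.polynomial [DecidableEq ι] {b : Module.Basis ι (Subring.center A) A}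
    {c : ι → Subring.center A} (h : IsMonomialBasis b c) :
    IsMonomialBasis (polynomialBasis b) fun i => centerC A (c i) := by
  constructor
  · intro i
    rw [polynomialBasis_apply, ← C_mul, h.mul_self]
    rfl
  · intro i j hij l
    obtain ⟨m, hm, z, hz⟩ := h.mul_ne i j hij l
    refine ⟨m, hm, centerC A z, ?_⟩
    simp only [polynomialBasis_apply]
    rw [← C_mul, ← C_mul, hz]
    exact C_mul

end Polynomial
end DiscAut
end

noncomputable section
namespace DiscAut.SkewPoly
open Finsupp

/-! ### Monomials up to sign -/

section CommRing
variable {k : Type*} [CommRing k] {n : ℕ}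

/-- `f` is plus or minus the monomial with exponent `p`. -/
def IsSignedMonomial (f : SkewPoly k n) (p : Fin n →₀ ℕ) : Prop :=
  ∃ m : ℕ, f = (-1 : k) ^ m • mon k n p

lemma isSignedMonomial_mon (p : Fin n →₀ ℕ) : IsSignedMonomial (mon k n p) p :=
  ⟨0, by rw [pow_zero, one_smul]⟩

lemma isSignedMonomial_one : IsSignedMonomial (1 : SkewPoly k n) 0 := by
  rw [← mon_zero]
  exact isSignedMonomial_mon 0

lemma isSignedMonomial_x (i : Fin n) : IsSignedMonomial (x k n i) (single i 1) := by
  rw [← mon_single]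
  exact isSignedMonomial_mon _

lemma IsSignedMonomial.mul {f g : SkewPoly k n} {p q : Fin n →₀ ℕ} (hf : IsSignedMonomial f p)
    (hg : IsSignedMonomial g q) : IsSignedMonomial (f * g) (p + q) := by
  obtain ⟨a, rfl⟩ := hf
  obtain ⟨b, rfl⟩ := hg
  obtain ⟨m, hm⟩ := mon_mul_mon (k := k) p q
  exact ⟨a + b + m, by rw [smul_mul_smul_comm, hm, smul_smul, pow_add, pow_add]⟩

lemma IsSignedMonomial.pow {f : SkewPoly k n} {p : Fin n →₀ ℕ} (hf : IsSignedMonomial f p)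
    (m : ℕ) : IsSignedMonomial (f ^ m) (m • p) := by
  induction m with
  | zero => simpa using isSignedMonomial_one
  | succ m ih => rw [pow_succ, succ_nsmul]; exact ih.mul hf

lemma isSignedMonomial_list_prod {ι : Type*} {f : ι → SkewPoly k n} {p : ι → Fin n →₀ ℕ}
    (h : ∀ i, IsSignedMonomial (f i) (p i)) (l : List ι) :
    IsSignedMonomial (l.map f).prod (l.map p).sum := by
  induction l with
  | nil => simpa using isSignedMonomial_one
  | cons i l ih =>
    simp only [List.map_cons, List.prod_cons, List.sum_cons]
    exact (h i).mul ih

lemma IsSignedMonomial.eq_smul {f g : SkewPoly k n} {p : Fin n →₀ ℕ} (hf : IsSignedMonomial f p)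
    (hg : IsSignedMonomial g p) : ∃ m : ℕ, f = (-1 : k) ^ m • g := by
  obtain ⟨a, rfl⟩ := hf
  obtain ⟨b, rfl⟩ := hg
  exact ⟨a + b, by rw [smul_smul, pow_add, mul_assoc, neg_one_pow_mul_self, mul_one]⟩

lemma IsSignedMonomial.isMonomial [Nontrivial k] {f : SkewPoly k n} {p : Fin n →₀ ℕ}
    (hf : IsSignedMonomial f p) : IsMonomial f p := by
  obtain ⟨m, rfl⟩ := hf
  refine isMonomial_iff.2 ⟨_, fun h => ?_, rfl⟩
  have := neg_one_pow_mul_self (k := k) m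
  rw [h, zero_mul] at this
  exact zero_ne_one this

/-! ### The center -/

/-- Moving a variable across `f` only changes signs of coefficients, so commutation relations become
parity conditions on exponents. -/
lemma exists_x_mul_eq_mul_x (i : Fin n) (f : SkewPoly k n) : ∃ g, x k n i * f = g * x k n i ∧
    ∀ p, (mon k n).repr g p = (-1) ^ (p.degree + p i) * (mon k n).repr f p := by
  refine ⟨∑ p ∈ ((mon k n).repr f).support,
    ((-1) ^ (p.degree + p i) * (mon k n).repr f p) • mon k n p, ?_, fun p => ?_⟩
  · conv_lhs => rw [sum_mon f]
    rw [Finset.mul_sum, Finset.sum_mul]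
    refine Finset.sum_congr rfl fun p _ => ?_
    rw [mul_smul_comm, x_mul_mon, smul_smul, smul_mul_assoc, mul_comm]
  · simp only [map_sum, map_smul, Module.Basis.repr_self, smul_single, smul_eq_mul, mul_one,
      finsetSum_apply, single_apply]
    rw [Finset.sum_ite_eq']
    split_ifs with h
    · rfl
    · rw [notMem_support_iff.1 h, mul_zero]

lemma mem_center_of_commute_x {f : SkewPoly k n} (h : ∀ i, x k n i * f = f * x k n i) :
    f ∈ Subring.center (SkewPoly k n) := by
  rw [Subring.mem_center_iff]
  intro g
  have hg : g ∈ Algebra.adjoin k (Set.range (x k n)) := adjoin_range_x (k := k) ▸ trivial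
  induction hg using Algebra.adjoin_induction with
  | mem g hg =>
    obtain ⟨i, rfl⟩ := hg
    exact h i
  | algebraMap r => exact Algebra.commutes r f
  | add a b _ _ ha hb => rw [add_mul, mul_add, ha, hb]
  | mul a b _ _ ha hb => rw [mul_assoc, hb, ← mul_assoc, ha, mul_assoc]

lemma smul_mem_center {A : Type*} [Ring A] [Algebra k A] (c : k) {f : A}
    (hf : f ∈ Subring.center A) : c • f ∈ Subring.center A := by
  rw [Subring.mem_center_iff] at *
  intro g
  rw [mul_smul_comm, smul_mul_assoc, hf]

lemma mon_mem_center {p : Fin n →₀ ℕ} (h : ∀ i, Even (p i)) :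
    mon k n p ∈ Subring.center (SkewPoly k n) := by
  refine mem_center_of_commute_x fun i => ?_
  have hd : Even p.degree := by
    rw [degree_eq_sum]
    exact Finset.even_sum _ fun i _ => h i
  rw [x_mul_mon, (hd.add (h i)).neg_one_pow, one_smul]

lemma isSignedMonomial_mem_center {f : SkewPoly k n} {p : Fin n →₀ ℕ}
    (hf : IsSignedMonomial f p) (h : ∀ i, Even (p i)) : f ∈ Subring.center (SkewPoly k n) := by
  obtain ⟨m, rfl⟩ := hf
  exact smul_mem_center _ (mon_mem_center h)

lemma squares_le_center {f : SkewPoly k n} (hf : f ∈ squares k n) :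
    f ∈ Subring.center (SkewPoly k n) := by
  induction hf using Algebra.adjoin_induction with
  | mem g hg =>
    obtain ⟨i, rfl⟩ := hg
    refine isSignedMonomial_mem_center ((isSignedMonomial_x i).pow 2) fun j => ?_
    rw [Finsupp.smul_apply, smul_eq_mul]
    exact even_two_mul _
  | algebraMap r =>
    rw [Subring.mem_center_iff]
    exact fun g => (Algebra.commutes r g).symm
  | add a b _ _ ha hb => exact add_mem ha hb
  | mul a b _ _ ha hb => exact mul_mem ha hb

lemma sum_finRange_single (p : Fin n →₀ ℕ) :
    ((List.finRange n).map fun i => p i • single i 1).sum = p := by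
  rw [← List.ofFn_eq_map, List.sum_ofFn]
  ext j
  simp only [finsetSum_apply, Finsupp.smul_apply, smul_eq_mul, single_apply, mul_ite, mul_one,
    mul_zero]
  rw [Finset.sum_ite_eq', if_pos (Finset.mem_univ j)]

/-- Halving the exponents gives a product of powers of the $x_i^2$ with the same exponent, hence the
same monomial up to sign. -/
lemma mon_mem_squares {p : Fin n →₀ ℕ} (h : ∀ i, Even (p i)) : mon k n p ∈ squares k n := by
  have key : IsSignedMonomial ((List.finRange n).map fun i => (x k n i ^ 2) ^ (p i / 2)).prod p := by
    have := isSignedMonomial_list_prod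
      (fun i => (isSignedMonomial_x (k := k) (n := n) i).pow (p i)) (List.finRange n)
    rw [sum_finRange_single] at this
    convert this using 4 with i
    rw [← pow_mul, Nat.mul_div_cancel' (h i).two_dvd]
  obtain ⟨m, hm⟩ := (isSignedMonomial_mon p).eq_smul key
  rw [hm]
  refine Subalgebra.smul_mem _ (Subalgebra.list_prod_mem _ ?_) _
  intro f hf
  obtain ⟨i, -, rfl⟩ := List.mem_map.1 hf
  exact Subalgebra.pow_mem _ (Algebra.subset_adjoin (Set.mem_range_self i)) _

/-! ### Squarefree monomials and the discriminant -/

/-- The exponent of the squarefree monomial with the given support. -/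
def sqfreeExponent (S : Finset (Fin n)) : Fin n →₀ ℕ :=
  equivFunOnFinite.symm fun i => if i ∈ S then 1 else 0

lemma sqfreeExponent_apply (S : Finset (Fin n)) (i : Fin n) :
    sqfreeExponent S i = if i ∈ S then 1 else 0 := rfl

/-- The variables that occur with odd exponent. -/
def parity (p : Fin n →₀ ℕ) : Finset (Fin n) := Finset.univ.filter fun i => Odd (p i)

lemma mem_parity {p : Fin n →₀ ℕ} {i : Fin n} : i ∈ parity p ↔ Odd (p i) := by simp [parity]

lemma eq_add_sqfreeExponent_parity (p : Fin n →₀ ℕ) :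
    ∃ q : Fin n →₀ ℕ, p = 2 • q + sqfreeExponent (parity p) := by
  refine ⟨equivFunOnFinite.symm fun i => p i / 2, ?_⟩
  ext i
  have := Nat.odd_iff (n := p i)
  simp only [Finsupp.add_apply, Finsupp.smul_apply, sqfreeExponent_apply, mem_parity, smul_eq_mul,
    equivFunOnFinite_symm_apply_apply]
  split_ifs <;> grind

lemma parity_add_sqfreeExponent {p : Fin n →₀ ℕ} (hp : ∀ i, Even (p i)) (S : Finset (Fin n)) :
    parity (p + sqfreeExponent S) = S := by
  ext i
  have := hp i
  rw [mem_parity, Finsupp.add_apply, sqfreeExponent_apply, Nat.odd_add]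
  split_ifs with h <;> simp [h, this]

/-- Split the exponent as an even part plus its reduction modulo 2; the even part gives a central
monomial. -/
lemma exists_mon_eq_smul (p : Fin n →₀ ℕ) : ∃ z : Subring.center (SkewPoly k n),
    mon k n p = z • mon k n (sqfreeExponent (parity p)) := by
  obtain ⟨q, hq⟩ := eq_add_sqfreeExponent_parity p
  obtain ⟨m, hm⟩ := mon_mul_mon (k := k) (2 • q) (sqfreeExponent (parity p))
  refine ⟨⟨(-1 : k) ^ m • mon k n (2 • q), smul_mem_center _ (mon_mem_center fun i => ?_)⟩, ?_⟩
  · rw [Finsupp.smul_apply, smul_eq_mul]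
    exact even_two_mul _
  · change _ = ((-1 : k) ^ m • mon k n (2 • q)) * mon k n _
    rw [smul_mul_assoc, hm, smul_smul, neg_one_pow_mul_self, one_smul, ← hq]

/-- The square of a squarefree monomial. -/
def sqfreeSq (k : Type*) [CommRing k] {n : ℕ} (S : Finset (Fin n)) :
    Subring.center (SkewPoly k n) :=
  ⟨mon k n (sqfreeExponent S) * mon k n (sqfreeExponent S),
    isSignedMonomial_mem_center ((isSignedMonomial_mon _).mul (isSignedMonomial_mon _))
      fun _ => ⟨_, rfl⟩⟩

/-- The exponent of the discriminant. -/
def discExponent (n : ℕ) : Fin n →₀ ℕ :=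
  ∑ S : Finset (Fin n), (sqfreeExponent S + sqfreeExponent S)

lemma discExponent_apply (i : Fin n) : discExponent n i =
    ∑ S : Finset (Fin n), (sqfreeExponent S i + sqfreeExponent S i) := by
  simp [discExponent]

lemma even_discExponent (i : Fin n) : Even (discExponent n i) := by
  rw [discExponent_apply]
  exact Finset.even_sum _ fun S _ => ⟨_, rfl⟩

lemma discExponent_pos (i : Fin n) : 0 < discExponent n i := by
  rw [discExponent_apply]
  refine Finset.sum_pos' (fun _ _ => Nat.zero_le _) ⟨Finset.univ, Finset.mem_univ _, ?_⟩
  simp [sqfreeExponent_apply]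

lemma isSignedMonomial_prod_sqfreeSq :
    IsSignedMonomial ((∏ S, sqfreeSq k S : Subring.center (SkewPoly k n)) : SkewPoly k n)
      (discExponent n) := by
  rw [discExponent]
  induction (Finset.univ : Finset (Finset (Fin n))) using Finset.induction_on with
  | empty => exact isSignedMonomial_one
  | insert S s hS ih =>
    rw [Finset.prod_insert hS, Finset.sum_insert hS]
    exact ((isSignedMonomial_mon _).mul (isSignedMonomial_mon _)).mul ih

/-- The ordered monomial which generates the discriminant ideal. -/
def discMonomial (k : Type*) [CommRing k] (n : ℕ) : SkewPoly k n :=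
  ((List.finRange n).map fun i => x k n i ^ discExponent n i).prod

lemma isSignedMonomial_discMonomial : IsSignedMonomial (discMonomial k n) (discExponent n) := by
  have := isSignedMonomial_list_prod
    (fun i => (isSignedMonomial_x (k := k) (n := n) i).pow (discExponent n i)) (List.finRange n)
  rwa [sum_finRange_single] at this

lemma isUnit_card_center {A : Type*} [Ring A] [Algebra k A] (h2 : IsUnit (2 : k)) (n : ℕ) :
    IsUnit (Fintype.card (Finset (Fin n)) : Subring.center A) := by
  let f : k →+* Subring.center A := (algebraMap k A).codRestrict _ fun r => by
    rw [Subring.mem_center_iff]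
    exact fun a => (Algebra.commutes r a).symm
  have := h2.map f
  rw [map_ofNat] at this
  rw [Fintype.card_finset, Fintype.card_fin, Nat.cast_pow]
  exact this.pow n

end CommRing

variable {k : Type*} [CommRing k] [IsDomain k] {n : ℕ}

instance : IsDomain (SkewPoly k n) := NoZeroDivisors.to_isDomain _

/-- Commuting with $x_i$ forces $|p|+p_i$ to be even, because $2\ne0$ in $k$. Summing over $i$ gives
that $(n+1)|p|$ is even. As $n$ is even, so is $|p|$, and then so is each $p_i$. -/
lemma even_of_mem_center (h2 : IsUnit (2 : k)) (hn : Even n) {f : SkewPoly k n}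
    (hf : f ∈ Subring.center (SkewPoly k n)) {p : Fin n →₀ ℕ}
    (hp : p ∈ ((mon k n).repr f).support) (i : Fin n) : Even (p i) := by
  have hs : ∀ i, Even (p.degree + p i) := by
    intro i
    obtain ⟨g, hg, hgf⟩ := exists_x_mul_eq_mul_x i f
    have h4 := mul_right_cancel₀ (isMonomial_x i).ne_zero
      ((Subring.mem_center_iff.1 hf _).symm.trans hg)
    have h5 := hgf p
    rw [← h4, mul_comm] at h5
    have h6 := mul_left_cancel₀ (mem_support_iff.1 hp) ((mul_one _).trans h5)
    by_contra hodd
    rw [Nat.not_even_iff_odd] at hodd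
    rw [hodd.neg_one_pow] at h6
    have : (2 : k) = 0 := by linear_combination h6
    exact h2.ne_zero this
  have hd : Even p.degree := by
    have : Even (∑ i, (p.degree + p i)) := Finset.even_sum _ fun i _ => hs i
    rw [Finset.sum_add_distrib, ← degree_eq_sum, Finset.sum_const, Finset.card_univ,
      Fintype.card_fin, smul_eq_mul, Nat.even_add] at this
    exact this.1 (hn.mul_right _)
  exact (Nat.even_add.1 (hs i)).1 hd

lemma center_le_squares (h2 : IsUnit (2 : k)) (hn : Even n) {f : SkewPoly k n}
    (hf : f ∈ Subring.center (SkewPoly k n)) : f ∈ squares k n := by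
  rw [sum_mon f]
  exact Subalgebra.sum_mem _ fun p hp =>
    Subalgebra.smul_mem _ (mon_mem_squares (even_of_mem_center h2 hn hf hp)) _

/-! ### The basis over the center -/

/-- The squarefree monomials form a basis of `k₋₁[x₁, …, xₙ]` over its center. -/
def centralBasis (h2 : IsUnit (2 : k)) (hn : Even n) :
    Module.Basis (Finset (Fin n)) (Subring.center (SkewPoly k n)) (SkewPoly k n) :=
  Module.Basis.mk (v := fun S => mon k n (sqfreeExponent S))
    (by
      rw [Fintype.linearIndependent_iff]
      intro g hg S
      have heven := fun T p hp => even_of_mem_center (p := p) h2 hn (g T).2 hp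
      by_contra hne
      have hne' : (mon k n).repr (g S : SkewPoly k n) ≠ 0 := by
        rw [Ne, LinearEquiv.map_eq_zero_iff]
        exact fun h => hne (Subtype.ext h)
      obtain ⟨p, hp⟩ := support_nonempty_iff.2 hne'
      have hsum := congrArg (fun f => (mon k n).repr f (p + sqfreeExponent S)) hg
      simp only [map_sum, finsetSum_apply, map_zero, coe_zero, Pi.zero_apply] at hsum
      have hsupp : ∀ T, ∀ q ∈ ((mon k n).repr (mon k n (sqfreeExponent T))).support,
          q = sqfreeExponent T := fun T q hq => by
        rw [isMonomial_mon (sqfreeExponent T), Finset.mem_singleton] at hq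
        exact hq
      -- Coefficients have even exponents, so the parity of an exponent in a term determines the
      -- squarefree monomial. Different sets thus contribute to disjoint exponents.
      rw [Finset.sum_eq_single S] at hsum
      · refine mem_support_iff.1 (repr_mul_ne_zero_of_unique (f := (g S : SkewPoly k n))
          (g := mon k n (sqfreeExponent S)) hp ?_ ?_) hsum
        · rw [isMonomial_mon (sqfreeExponent S)]
          exact Finset.mem_singleton_self _
        · intro p' _ q' hq' h
          rw [hsupp S q' hq'] at h ⊢
          exact ⟨add_right_cancel h, rfl⟩
      · intro T _ hT
        refine repr_mul_eq_zero (g T : SkewPoly k n) (mon k n (sqfreeExponent T)) _ ?_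
        intro p' hp' q' hq' h
        rw [hsupp T q' hq'] at h
        apply hT
        rw [← parity_add_sqfreeExponent (heven T p' hp') T, h,
          parity_add_sqfreeExponent (heven S p hp)]
      · simp)
    (by
      intro f _
      rw [sum_mon f]
      refine Submodule.sum_mem _ fun p _ => ?_
      obtain ⟨z, hz⟩ := exists_mon_eq_smul (k := k) p
      have : (mon k n).repr f p • mon k n p =
          (⟨(mon k n).repr f p • (z : SkewPoly k n), smul_mem_center _ z.2⟩ :
            Subring.center (SkewPoly k n)) • mon k n (sqfreeExponent (parity p)) := by
        rw [hz]
        exact (smul_mul_assoc _ _ _).symm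
      rw [this]
      exact Submodule.smul_mem _ _ (Submodule.subset_span ⟨_, rfl⟩))

lemma centralBasis_apply (h2 : IsUnit (2 : k)) (hn : Even n) (S : Finset (Fin n)) :
    centralBasis h2 hn S = mon k n (sqfreeExponent S) :=
  Module.Basis.mk_apply _ _ S

/-- The parity of a product of three squarefree monomials is the symmetric difference $S\triangle
T\triangle U$, which equals $U$ only if $S=T$. -/
lemma isMonomialBasis_centralBasis (h2 : IsUnit (2 : k)) (hn : Even n) :
    IsMonomialBasis (centralBasis h2 hn) (sqfreeSq k) := by
  constructor
  · intro S
    rw [centralBasis_apply]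
    rfl
  · intro S T hST U
    simp only [centralBasis_apply]
    obtain ⟨m, hm⟩ := ((isSignedMonomial_mon (k := k) (sqfreeExponent S)).mul
      (isSignedMonomial_mon (sqfreeExponent T))).mul (isSignedMonomial_mon (sqfreeExponent U))
    obtain ⟨z, hz⟩ := exists_mon_eq_smul (k := k)
      (sqfreeExponent S + sqfreeExponent T + sqfreeExponent U)
    refine ⟨parity (sqfreeExponent S + sqfreeExponent T + sqfreeExponent U), ?_,
      ⟨(-1 : k) ^ m • (z : SkewPoly k n), smul_mem_center _ z.2⟩, ?_⟩
    · intro h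
      apply hST
      ext i
      have := congrArg (i ∈ ·) h
      simp only [mem_parity, Finsupp.add_apply, sqfreeExponent_apply] at this
      by_cases hS : i ∈ S <;> by_cases hT : i ∈ T <;> by_cases hU : i ∈ U <;>
        simp_all [Nat.odd_iff]
    · rw [hm, hz]
      exact (smul_mul_assoc _ _ _).symm

theorem inAf (h2 : IsUnit (2 : k)) (hn : Even n) : InAf k (x k n) where
  flat := inferInstance
  linearIndependent := by
    have : x k n = mon k n ∘ fun i => single i 1 := funext fun i => (mon_single i).symm
    rw [this]
    exact (mon k n).linearIndependent.comp _ (single_left_injective one_ne_zero)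
  disjoint := by
    have h := (mon k n).linearIndependent.disjoint_span_image (s := {0})
      (t := Set.range fun i => single i 1) (by
        rw [Set.disjoint_singleton_left]
        rintro ⟨i, hi⟩
        exact one_ne_zero (single_eq_zero.1 hi))
    rw [Set.image_singleton, mon_zero, ← Submodule.one_eq_span, ← Set.range_comp] at h
    have hx : (mon k n ∘ fun i => single i 1) = x k n := funext mon_single
    rw [hx] at h
    exact h
  generates := adjoin_range_x
  exhaustive := stdFiltration_isExhaustive
  gr_domain := isConnectedGradedDomain
  finite := Module.Finite.of_basis (centralBasis h2 hn)
  free := Module.Free.of_basis (centralBasis h2 hn)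
  dominating := by
    refine ⟨⟨discMonomial k n, isSignedMonomial_mem_center isSignedMonomial_discMonomial
      even_discExponent⟩, ?_, isDominating_of_eq_prod discExponent_pos rfl
        isSignedMonomial_discMonomial.isMonomial.ne_zero⟩
    rw [(isMonomialBasis_centralBasis h2 hn).discIdeal_finrank (isUnit_card_center h2 n)]
    -- Two central elements that are both plus or minus the same monomial generate the same ideal.
    -- This replaces the product of squares by the ordered monomial needed for domination.
    have key : ∀ {a b : Subring.center (SkewPoly k n)}, IsSignedMonomial (a : SkewPoly k n)
        (discExponent n) → IsSignedMonomial (b : SkewPoly k n) (discExponent n) →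
        Ideal.span {a} ≤ Ideal.span {b} := by
      intro a b ha hb
      rw [Ideal.span_singleton_le_iff_mem, Ideal.mem_span_singleton']
      obtain ⟨m, hm⟩ := ha.eq_smul hb
      refine ⟨⟨(-1 : k) ^ m • 1, smul_mem_center _ (one_mem _)⟩, Subtype.ext ?_⟩
      rw [hm]
      exact smul_one_mul _ _
    exact le_antisymm (key isSignedMonomial_prod_sqfreeSq isSignedMonomial_discMonomial)
      (key isSignedMonomial_discMonomial isSignedMonomial_prod_sqfreeSq)

end DiscAut.SkewPoly
end

noncomputable section
namespace DiscAut.SkewPoly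
open Finsupp Polynomial

section CommRing
variable {k : Type*} [CommRing k] {n : ℕ}

lemma eq_of_smul_x_eq {r s : k} {i j : Fin n} (h : r • x k n i = s • x k n j) (hr : r ≠ 0) :
    i = j ∧ r = s := by
  rw [← mon_single, ← mon_single] at h
  have h' := congrArg (mon k n).repr h
  simp only [map_smul, Module.Basis.repr_self, smul_single, smul_eq_mul, mul_one] at h'
  rcases single_eq_single_iff _ _ _ _ |>.1 h' with ⟨h, h'⟩ | ⟨h, -⟩
  · exact ⟨single_left_injective one_ne_zero h, h'⟩
  · exact (hr h).elim

/-! ### The triangular group of automorphisms of the polynomial extension -/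

/-- The endomorphism of `k₋₁[x₁, …, xₙ][t]` given by a triangular matrix. -/
def triangularHom (m : Triangular k n) : (SkewPoly k n)[X] →ₐ[k] (SkewPoly k n)[X] :=
  eval₂AlgHom (CAlgHom.comp (monomialAut m.g).toAlgHom) ((m.c : k) • X + C (m.r : SkewPoly k n))
    fun a => by
      -- The image of the variable must commute with the image of the coefficients; this holds
      -- because `m.r` lies in `squares` and is central.
      change C (monomialAut m.g a) * _ = _ * C (monomialAut m.g a)
      rw [mul_add, add_mul, ← C_mul, ← C_mul,
        Subring.mem_center_iff.1 (squares_le_center m.r.2), mul_smul_comm, smul_mul_assoc, X_mul_C]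

lemma triangularHom_C (m : Triangular k n) (a : SkewPoly k n) :
    triangularHom m (C a) = C (monomialAut m.g a) :=
  eval₂_C _ _

lemma triangularHom_X (m : Triangular k n) :
    triangularHom m X = (m.c : k) • X + C (m.r : SkewPoly k n) :=
  eval₂_X _ _

lemma algHom_polynomial_ext {A : Type*} [Ring A] [Algebra k A] {f g : A[X] →ₐ[k] A[X]}
    (hC : ∀ a, f (C a) = g (C a)) (hX : f X = g X) : f = g :=
  Polynomial.algHom_ext' (AlgHom.ext hC) hX

lemma triangularHom_mul (m m' : Triangular k n) :
    triangularHom (m * m') = (triangularHom m).comp (triangularHom m') := by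
  refine algHom_polynomial_ext (fun a => ?_) ?_
  · simp only [AlgHom.comp_apply, triangularHom_C, TriangularGroup.mul_g, map_mul]
    rfl
  · have hr : ((squaresRep k n m.g m'.r : squares k n) : SkewPoly k n) = monomialAut m.g m'.r := rfl
    simp only [AlgHom.comp_apply, triangularHom_X, map_add, map_smul, triangularHom_C,
      TriangularGroup.mul_c, TriangularGroup.mul_r, Subalgebra.coe_add, Subalgebra.coe_smul, hr,
      smul_add, smul_smul, ← smul_C, Units.val_mul, mul_comm (m'.c : k)]
    rw [add_comm (C _), add_assoc]

lemma triangularHom_one : triangularHom (1 : Triangular k n) = AlgHom.id k _ := by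
  refine algHom_polynomial_ext (fun a => ?_) ?_
  · rw [triangularHom_C, TriangularGroup.one_g, map_one]
    rfl
  · simp [triangularHom_X]

/-- The action of triangular matrices on `k₋₁[x₁, …, xₙ][t]`. -/
def triangularAut : Triangular k n →* ((SkewPoly k n)[X] ≃ₐ[k] (SkewPoly k n)[X]) where
  toFun m := AlgEquiv.ofAlgHom (triangularHom m) (triangularHom m⁻¹)
    (by rw [← triangularHom_mul, mul_inv_cancel, triangularHom_one])
    (by rw [← triangularHom_mul, inv_mul_cancel, triangularHom_one])
  map_one' := AlgEquiv.ext fun f => DFunLike.congr_fun triangularHom_one f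
  map_mul' m m' := AlgEquiv.ext fun f => DFunLike.congr_fun (triangularHom_mul m m') f

lemma triangularAut_C (m : Triangular k n) (a : SkewPoly k n) :
    triangularAut m (C a) = C (monomialAut m.g a) := triangularHom_C m a

lemma triangularAut_X (m : Triangular k n) :
    triangularAut m X = (m.c : k) • X + C (m.r : SkewPoly k n) := triangularHom_X m

lemma map_X_mem_center {A : Type*} [Ring A] [Algebra k A] (φ : A[X] ≃ₐ[k] A[X]) :
    φ X ∈ Subring.center A[X] := by
  rw [Subring.mem_center_iff]
  intro g
  rw [← φ.apply_symm_apply g, ← map_mul, ← map_mul, X_mul]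

/-- An automorphism of `A[t]`, `A` a domain, that preserves `A` is affine in `t`. -/
lemma exists_map_X_eq {A : Type*} [Ring A] [IsDomain A] [Algebra k A] (φ : A[X] ≃ₐ[k] A[X])
    (α : A ≃ₐ[k] A) (h : ∀ a, φ (C a) = C (α a)) :
    ∃ a c r : A, a * c = 1 ∧ φ X = C c * X + C r := by
  -- `φ` twists the coefficients by `α` and substitutes `φ X` for the variable. Writing `X` as a
  -- value of `φ` then forces both degrees in the composition to be one, and the leading
  -- coefficients to multiply to 1.
  have hcomp : ∀ q : A[X], φ q = (q.map α.toRingEquiv.toRingHom).comp (φ X) := by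
    intro q
    induction q using Polynomial.induction_on' with
    | add p q hp hq => rw [map_add, Polynomial.map_add, add_comp, hp, hq]
    | monomial m a =>
      rw [map_monomial, monomial_comp, ← C_mul_X_pow_eq_monomial, map_mul, map_pow, h]
      rfl
  have hX := hcomp (φ.symm X)
  rw [φ.apply_symm_apply] at hX
  set q := (φ.symm X).map α.toRingEquiv.toRingHom
  have hdeg := congrArg natDegree hX
  rw [natDegree_X, natDegree_comp] at hdeg
  obtain ⟨hq, hf⟩ := mul_eq_one.1 hdeg.symm
  have hlead := congrArg leadingCoeff hX
  rw [leadingCoeff_comp (by omega), hq, pow_one, leadingCoeff_X] at hlead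
  refine ⟨_, _, (φ X).coeff 0, hlead.symm, ?_⟩
  rw [leadingCoeff, hf]
  exact eq_X_add_C_of_natDegree_le_one hf.le

lemma exists_C_of_mul_eq_C {A : Type*} [Semiring A] [NoZeroDivisors A] {f g : A[X]} {a : A}
    (ha : a ≠ 0) (h : f * g = C a) : (∃ b, f = C b) ∧ ∃ b, g = C b := by
  have hf : f ≠ 0 := fun e => ha (C_eq_zero.1 (by rw [← h, e, zero_mul]))
  have hg : g ≠ 0 := fun e => ha (C_eq_zero.1 (by rw [← h, e, mul_zero]))
  have := congrArg natDegree h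
  rw [natDegree_mul hf hg, natDegree_C, Nat.add_eq_zero_iff] at this
  exact ⟨⟨_, eq_C_of_natDegree_eq_zero this.1⟩, ⟨_, eq_C_of_natDegree_eq_zero this.2⟩⟩

end CommRing

variable {k : Type*} [CommRing k] [IsDomain k] {n : ℕ}

/-! ### Automorphisms of the polynomial extension -/

/-- Nonscalar elements `yᵢ` such that `∏ yᵢ^{Nᵢ}` divides `∏ xᵢ^{Nᵢ}` are, up to order and
scalars, the generators. -/
lemma exists_perm_of_prod_pow_mul {N : Fin n →₀ ℕ} (hN : ∀ i, 0 < N i)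
    {y : Fin n → SkewPoly k n} {z : SkewPoly k n}
    (h : IsMonomial (((List.finRange n).map fun i => y i ^ N i).prod * z) N)
    (hy : ∀ i, ¬ IsMonomial (y i) 0) :
    ∃ σ : Equiv.Perm (Fin n), ∀ i, ∃ r : k, y i = r • x k n (σ i) := by
  obtain ⟨c, q, hcq, hc, -⟩ := h.of_mul
  have hfac : ∀ (l : List (Fin n)) (c : Fin n →₀ ℕ),
      IsMonomial (l.map fun i => y i ^ N i).prod c → ∀ i ∈ l, ∃ p, IsMonomial (y i) p := by
    intro l
    induction l with
    | nil => simp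
    | cons j l ih =>
      intro c hc i hi
      rw [List.map_cons, List.prod_cons] at hc
      obtain ⟨p, q, -, hp, hq⟩ := hc.of_mul
      rcases List.mem_cons.1 hi with rfl | hi
      -- Positivity of the exponent makes `y i` itself a factor of the monomial.
      · rw [← Nat.succ_pred_eq_of_pos (hN i), pow_succ] at hp
        obtain ⟨-, p, -, -, hp⟩ := hp.of_mul
        exact ⟨p, hp⟩
      · exact ih q hq i hi
  choose p hp using fun i => hfac _ c hc i (List.mem_finRange i)
  have hprod : ∀ l : List (Fin n),
      IsMonomial (l.map fun i => y i ^ N i).prod (l.map fun i => N i • p i).sum := by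
    intro l
    induction l with
    | nil => simpa using isMonomial_one
    | cons i l ih => simpa using ((hp i).pow (N i)).mul ih
  have hcs : c = ∑ i, N i • p i := by
    rw [hc.unique (hprod _), ← List.ofFn_eq_map, List.sum_ofFn]
  have hpos : ∀ i, 1 ≤ (p i).degree := fun i => by
    rw [Nat.one_le_iff_ne_zero, Ne, degree_eq_zero_iff]
    exact fun e => hy i (e ▸ hp i)
  have hdeg : ∑ i, N i * (p i).degree + q.degree = ∑ i, N i := by
    have := congrArg Finsupp.degree hcq
    rw [map_add, hcs, map_sum, degree_eq_sum N] at this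
    simpa using this
  -- Each degree is at least one, while the weighted degrees total at most $\sum N_i$. Hence all
  -- degrees are one and the cofactor is a scalar.
  have hle : ∀ i ∈ Finset.univ, N i ≤ N i * (p i).degree := fun i _ =>
    Nat.le_mul_of_pos_right _ (hpos i)
  have hsum := Finset.sum_le_sum hle
  have hq : q = 0 := by
    rw [← degree_eq_zero_iff]
    omega
  have hp1 : ∀ i, (p i).degree = 1 := fun i => by
    have := (Finset.sum_eq_sum_iff_of_le hle).1 (by omega) i (Finset.mem_univ i)
    exact Nat.eq_of_mul_eq_mul_left (hN i) (by rw [← this, mul_one])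
  choose σ hσ using fun i => (sum_eq_one_iff (p i)).1 (hp1 i)
  -- A variable missed by `σ` would be absent from the product, but it has positive exponent `N j`
  -- there.
  have hsurj : Function.Surjective σ := by
    intro j
    by_contra! hj
    have := congrArg (fun f => f j) hcq
    rw [hq, add_zero, hcs] at this
    simp only [finsetSum_apply, Finsupp.smul_apply] at this
    rw [Finset.sum_eq_zero fun i _ => by rw [hσ, single_eq_of_ne (hj i).symm, smul_zero]] at this
    exact (hN j).ne this
  refine ⟨Equiv.ofBijective σ (Finite.surjective_iff_bijective.1 hsurj), fun i => ?_⟩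
  obtain ⟨r, -, hr⟩ := isMonomial_iff.1 (hp i)
  exact ⟨r, by rw [hr, hσ, mon_single]; rfl⟩

/-- The image of the discriminant divides the discriminant, which is constant in the polynomial
variable. Factors of nonzero constants are constant, so the problem descends to factoring a monomial
in the coefficient ring. -/
lemma exists_perm_of_algEquiv (h2 : IsUnit (2 : k)) (hn : Even n)
    (φ : (SkewPoly k n)[X] ≃ₐ[k] (SkewPoly k n)[X]) :
    ∃ σ : Equiv.Perm (Fin n), ∀ i, ∃ r : k, φ (C (x k n i)) = C (r • x k n (σ i)) := by
  obtain ⟨z, hz⟩ := (isMonomialBasis_centralBasis h2 hn).polynomial.exists_map_mul_eq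
    (isUnit_card_center h2 n) φ.toRingEquiv
  set d := discMonomial k n with hd
  have hd0 : d ≠ 0 := isSignedMonomial_discMonomial.isMonomial.ne_zero
  obtain ⟨z, hz⟩ : ∃ z, φ (C d) * z = C d := by
    obtain ⟨m, hm⟩ := (isSignedMonomial_prod_sqfreeSq (k := k) (n := n)).eq_smul
      isSignedMonomial_discMonomial
    rw [← map_prod, coe_centerC, hm] at hz
    refine ⟨z, ?_⟩
    have hz' : φ (C ((-1 : k) ^ m • d)) * z = C ((-1 : k) ^ m • d) := hz
    rw [← smul_C, map_smul, smul_mul_assoc] at hz'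
    have := congrArg (fun f => (-1 : k) ^ m • f) hz'
    simpa only [smul_smul, neg_one_pow_mul_self, one_smul] using this
  have hC : ∀ i, ∃ b, φ (C (x k n i)) = C b := by
    have hlist : ∀ (l : List (Fin n)) (a : SkewPoly k n), a ≠ 0 →
        (l.map fun i => φ (C (x k n i)) ^ discExponent n i).prod = C a →
        ∀ i ∈ l, ∃ b, φ (C (x k n i)) = C b := by
      intro l
      induction l with
      | nil => simp
      | cons j l ih =>
        intro a ha hl i hi
        rw [List.map_cons, List.prod_cons] at hl
        obtain ⟨⟨b, hb⟩, c, hc⟩ := exists_C_of_mul_eq_C ha hl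
        rcases List.mem_cons.1 hi with rfl | hi
        · have hb0 : b ≠ 0 := fun e => ha (C_eq_zero.1 (by rw [← hl, hb, e, C_0, zero_mul]))
          rw [← Nat.succ_pred_eq_of_pos (discExponent_pos i), pow_succ] at hb
          exact (exists_C_of_mul_eq_C hb0 hb).2
        · refine ih c (fun e => ha (C_eq_zero.1 (by rw [← hl, hc, e, C_0, mul_zero]))) hc i hi
    obtain ⟨⟨b, hb⟩, -⟩ := exists_C_of_mul_eq_C hd0 hz
    have hb0 : b ≠ 0 := fun e => hd0 (C_eq_zero.1 (by rw [← hz, hb, e, C_0, zero_mul]))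
    refine fun i => hlist _ b hb0 ?_ i (List.mem_finRange i)
    rw [← hb, hd, discMonomial, map_list_prod, map_list_prod, List.map_map, List.map_map]
    simp [Function.comp_def]
  choose y hy using hC
  obtain ⟨-, z, rfl⟩ := exists_C_of_mul_eq_C hd0 hz
  have hφd : φ (C d) = C ((List.finRange n).map fun i => y i ^ discExponent n i).prod := by
    rw [hd, discMonomial, map_list_prod, map_list_prod, map_list_prod, List.map_map, List.map_map,
      List.map_map]
    simp [Function.comp_def, hy]
  rw [hφd, ← C_mul, C_inj] at hz
  obtain ⟨σ, hσ⟩ := exists_perm_of_prod_pow_mul (y := y) (z := z) discExponent_pos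
    -- An image $\varphi(x_i)$ that is a scalar would, by $k$-linearity and injectivity, make $x_i$
    -- a scalar.
    (by rw [hz]; exact isSignedMonomial_discMonomial.isMonomial) fun i hi => by
      obtain ⟨r, -, hr⟩ := isMonomial_iff.1 hi
      have h1 : φ (C (x k n i)) = φ (C (r • 1)) := by
        rw [hy, hr, mon_zero, ← smul_C, map_smul, C_1, map_one]
      have h3 := C_injective (φ.injective h1)
      have hr0 : r ≠ 0 := by
        rintro rfl
        exact (isMonomial_x i).ne_zero (h3.trans (zero_smul _ _))
      have h4 : IsMonomial (x k n i) 0 := isMonomial_iff.2 ⟨r, hr0, by rw [h3, mon_zero]⟩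
      have := congrArg Finsupp.degree ((isMonomial_x (k := k) i).unique h4)
      simp at this
  refine ⟨σ, fun i => ?_⟩
  obtain ⟨r, hr⟩ := hσ i
  exact ⟨r, by rw [hy, hr]⟩

/-- An automorphism of `k₋₁[x₁, …, xₙ][t]` restricts to a monomial automorphism of
`k₋₁[x₁, …, xₙ]`. -/
lemma exists_monomialAut (h2 : IsUnit (2 : k)) (hn : Even n)
    (φ : (SkewPoly k n)[X] ≃ₐ[k] (SkewPoly k n)[X]) :
    ∃ s : MonomialGroup k n, ∀ a, φ (C a) = C (monomialAut s a) := by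
  obtain ⟨σ, hσ⟩ := exists_perm_of_algEquiv h2 hn φ
  obtain ⟨τ, hτ⟩ := exists_perm_of_algEquiv h2 hn φ.symm
  choose r hr using hσ
  choose t ht using hτ
  -- The inverse automorphism is monomial too; applying it to the image of $x_i$ and comparing
  -- scalars shows that they are invertible.
  have hunit : ∀ i, r i * t (σ i) = 1 := by
    intro i
    have h := congrArg φ.symm (hr i)
    rw [φ.symm_apply_apply, ← smul_C, map_smul, ht, smul_C, smul_smul, C_inj,
      ← one_smul k (x k n i)] at h
    exact (eq_of_smul_x_eq h one_ne_zero).2.symm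
  refine ⟨⟨fun j => Units.mkOfMulEqOne (r (σ.symm j)) _ (hunit (σ.symm j)), σ⟩, fun a => ?_⟩
  have : φ.toAlgHom.comp CAlgHom = CAlgHom.comp (monomialAut (k := k) (n := n)
      ⟨fun j => Units.mkOfMulEqOne (r (σ.symm j)) _ (hunit (σ.symm j)), σ⟩).toAlgHom := by
    refine algHom_ext (B := (SkewPoly k n)[X]) ?_
    intro i
    change φ (C (x k n i)) = C (monomialAut _ (x k n i))
    rw [monomialAut_x, hr]
    simp
  exact DFunLike.congr_fun this a

lemma monomialAut_injective : Function.Injective (monomialAut (k := k) (n := n)) := by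
  intro s t h
  have hx : ∀ i, s.right i = t.right i ∧ (s.left (s.right i) : k) = t.left (t.right i) := by
    intro i
    have := DFunLike.congr_fun h (x k n i)
    rw [monomialAut_x, monomialAut_x] at this
    exact eq_of_smul_x_eq this (s.left (s.right i)).ne_zero
  have hr : s.right = t.right := Equiv.ext fun i => (hx i).1
  refine SemidirectProduct.ext (funext fun j => Units.ext ?_) hr
  have := (hx (s.right.symm j)).2
  rwa [← hr, Equiv.apply_symm_apply] at this

/-- An automorphism extends coefficientwise to the polynomial ring, where the discriminant argument
has already been carried out. -/
theorem monomialAut_bijective (h2 : IsUnit (2 : k)) (hn : Even n) :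
    Function.Bijective (monomialAut (k := k) (n := n)) := by
  refine ⟨monomialAut_injective, fun φ => ?_⟩
  obtain ⟨s, hs⟩ := exists_monomialAut h2 hn (Polynomial.mapAlgEquiv φ)
  refine ⟨s, AlgEquiv.ext fun a => C_injective ?_⟩
  rw [← hs]
  simp

theorem triangularAut_bijective (h2 : IsUnit (2 : k)) (hn : Even n) :
    Function.Bijective (triangularAut (k := k) (n := n)) := by
  constructor
  · intro m m' h
    have hg : m.g = m'.g := monomialAut_injective (AlgEquiv.ext fun a => C_injective (by
      rw [← triangularAut_C, ← triangularAut_C, h]))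
    have hX := DFunLike.congr_fun h X
    rw [triangularAut_X, triangularAut_X] at hX
    have h0 := congrArg (coeff · 0) hX
    have h1 := congrArg (coeff · 1) hX
    simp only [coeff_add, coeff_smul, coeff_X_zero, coeff_X_one, coeff_C_zero, smul_zero, zero_add,
      coeff_C_succ, add_zero] at h0 h1
    exact TriangularGroup.ext hg (Subtype.ext h0) (Units.ext (smul_one_injective h1))
  · intro φ
    obtain ⟨s, hs⟩ := exists_monomialAut h2 hn φ
    obtain ⟨a, c, r, hac, hX⟩ := exists_map_X_eq φ (monomialAut s) hs
    -- The coefficient of the variable is invertible, and units of the skew polynomial ring are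
    -- scalars.
    obtain ⟨u, rfl⟩ := exists_unit_of_mul_eq_one hac
    have hc : c = ((u⁻¹ : kˣ) : k) • (1 : SkewPoly k n) := by
      rw [← hac, smul_mul_assoc, smul_smul, Units.inv_mul, one_smul, one_mul]
    -- The variable is central, hence so is its image, and so is the constant coefficient of that
    -- image.
    have hr : r ∈ squares k n := by
      refine center_le_squares h2 hn ?_
      have := mem_center_polynomial_iff.1 (map_X_mem_center φ) 0
      simpa [hX] using this
    refine ⟨⟨s, ⟨r, hr⟩, u⁻¹⟩, AlgEquiv.ext fun f => ?_⟩
    refine DFunLike.congr_fun (f := (triangularAut ⟨s, ⟨r, hr⟩, u⁻¹⟩).toAlgHom) (g := φ.toAlgHom)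
      (algHom_polynomial_ext (fun a => ?_) ?_) f
    · exact (triangularAut_C _ a).trans (hs a).symm
    · refine (triangularAut_X _).trans ?_
      change _ = φ X
      rw [hX, hc, ← smul_C, C_1, smul_mul_assoc, one_mul]

end DiscAut.SkewPoly
end

noncomputable section
namespace DiscAut

/-! ### Locally nilpotent derivations -/

section General
variable {k A : Type*} [CommRing k] [Ring A] [Algebra k A] {D : A →ₗ[k] A}

lemma pow_apply_mul (hD : ∀ a b, D (a * b) = D a * b + a * D b) (m : ℕ) (a b : A) :
    (D ^ m) (a * b) = ∑ ij ∈ Finset.HasAntidiagonal.antidiagonal m,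
      m.choose ij.1 • ((D ^ ij.1) a * (D ^ ij.2) b) := by
  induction m with
  | zero => simp
  | succ m ih =>
    rw [Finset.sum_antidiagonal_choose_succ_nsmul fun i j => (D ^ i) a * (D ^ j) b, pow_succ',
      Module.End.mul_apply, ih, map_sum, ← Finset.sum_add_distrib]
    refine Finset.sum_congr rfl fun ij hij => ?_
    rw [map_nsmul, hD, ← Module.End.mul_apply, ← Module.End.mul_apply, ← pow_succ', ← pow_succ',
      nsmul_add, add_comm, Nat.choose_symm_of_eq_add (Finset.HasAntidiagonal.mem_antidiagonal.1 hij).symm]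

lemma IsLocallyNilpotentDerivation.exists_pow_ne_zero (hD : IsLocallyNilpotentDerivation D) {a : A}
    (ha : a ≠ 0) : ∃ p, (D ^ p) a ≠ 0 ∧ ∀ i, p < i → (D ^ i) a = 0 := by
  classical
  have hex := hD.2 a
  have h0 : Nat.find hex ≠ 0 := fun h => ha (by simpa [h] using Nat.find_spec hex)
  obtain ⟨p, hp⟩ := Nat.exists_eq_succ_of_ne_zero h0
  refine ⟨p, Nat.find_min hex (by omega), fun i hi => ?_⟩
  obtain ⟨j, rfl⟩ := Nat.exists_eq_add_of_le hi
  rw [add_comm, pow_add, Module.End.mul_apply, ← hp, Nat.find_spec hex, map_zero]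

/-- In characteristic zero, a locally nilpotent derivation of a domain kills the elements that
divide their own derivative. -/
lemma IsLocallyNilpotentDerivation.map_eq_zero_of_eq_mul [NoZeroDivisors A]
    (htors : ∀ (m : ℕ) (a : A), m ≠ 0 → m • a = 0 → a = 0)
    (hD : IsLocallyNilpotentDerivation D) {a g : A} (h : D a = a * g) : D a = 0 := by
  by_contra hne
  have ha : a ≠ 0 := fun e => hne (by rw [e, map_zero])
  have hg : g ≠ 0 := fun e => hne (by rw [h, e, mul_zero])
  obtain ⟨p, hp, hp'⟩ := hD.exists_pow_ne_zero ha
  obtain ⟨q, hq, hq'⟩ := hD.exists_pow_ne_zero hg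
  -- This is $D^{p+q+1}a=0$. By the Leibniz rule, it also equals a binomial coefficient times
  -- $D^p(a)\,D^q(g)$, since every other term contains a vanishing power.
  have h1 : (D ^ (p + q)) (a * g) = 0 := by
    rw [← h, ← Module.End.mul_apply, ← pow_succ]
    exact hp' _ (by omega)
  rw [pow_apply_mul hD.1, Finset.sum_eq_single (p, q)] at h1
  · exact mul_ne_zero hp hq (htors _ _ (Nat.choose_pos (Nat.le_add_right p q)).ne' h1)
  · rintro ⟨i, j⟩ hij hne'
    rw [Finset.HasAntidiagonal.mem_antidiagonal] at hij
    simp only at hij ⊢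
    rcases lt_trichotomy i p with hi | hi | hi
    · rw [hq' j (by omega), mul_zero, nsmul_zero]
    · exact (hne' (Prod.ext hi (by simp only; omega))).elim
    · rw [hp' i hi, zero_mul, nsmul_zero]
  · intro hmem
    exact (hmem (Finset.HasAntidiagonal.mem_antidiagonal.2 rfl)).elim

end General

/-! ### Derivations of the skew polynomial ring -/

namespace SkewPoly
open Finsupp

/-- Otherwise the sum of $|p|+p_j$ over $j\ne i$ would have $n-1$ odd terms and be odd. As $p_i=0$,
that sum is $n|p|$, which is even. -/
lemma exists_even_degree_add {n : ℕ} (hn : Even n) {i : Fin n} {p : Fin n →₀ ℕ} (hp : p i = 0) :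
    ∃ j, j ≠ i ∧ Even (p.degree + p j) := by
  by_contra! h
  have h1 : Odd (∑ j ∈ Finset.univ.erase i, (p.degree + p j)) := by
    rw [Finset.odd_sum_iff_odd_card_odd, Finset.filter_true_of_mem fun j hj =>
      Nat.not_even_iff_odd.1 (h j (Finset.ne_of_mem_erase hj)),
      Finset.card_erase_of_mem (Finset.mem_univ i), Finset.card_univ, Fintype.card_fin]
    exact Nat.Even.sub_odd i.pos hn odd_one
  have h2 := Finset.sum_erase_add Finset.univ (fun j => p.degree + p j) (Finset.mem_univ i)
  rw [Finset.sum_add_distrib (s := Finset.univ), ← degree_eq_sum, hp, add_zero, add_left_inj,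
    Finset.sum_const, Finset.card_univ, Fintype.card_fin, smul_eq_mul] at h2
  rw [h2] at h1
  exact Nat.not_even_iff_odd.2 h1 (hn.mul_right _)

lemma exists_eq_x_mul {k : Type*} [CommRing k] {n : ℕ} {i : Fin n} {f : SkewPoly k n}
    (h : ∀ p ∈ ((mon k n).repr f).support, p i ≠ 0) : ∃ g, f = x k n i * g := by
  rw [sum_mon f]
  refine Finset.sum_induction _ (fun f => ∃ g, f = x k n i * g) ?_ ⟨0, (mul_zero _).symm⟩ ?_
  · rintro _ _ ⟨a, rfl⟩ ⟨b, rfl⟩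
    exact ⟨a + b, (mul_add _ _ _).symm⟩
  · intro p hp
    have hle : single i 1 ≤ p := by
      rw [single_le_iff]
      exact Nat.one_le_iff_ne_zero.2 (h p hp)
    obtain ⟨m, hm⟩ := mon_mul_mon (k := k) (single i 1) (p - single i 1)
    rw [add_tsub_cancel_of_le hle, mon_single] at hm
    refine ⟨((mon k n).repr f p * (-1) ^ m) • mon k n (p - single i 1), ?_⟩
    rw [mul_smul_comm, hm, smul_smul, mul_assoc, neg_one_pow_mul_self, mul_one]

variable {k : Type*} [CommRing k] [IsDomain k] {n : ℕ}

/-- A derivation of `k₋₁[x₁, …, xₙ]`, `n` even, maps `xᵢ` to a multiple of `xᵢ`. -/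
lemma exists_derivation_x_eq (h2 : IsUnit (2 : k)) (hn : Even n)
    {D : SkewPoly k n →ₗ[k] SkewPoly k n} (hD : ∀ a b, D (a * b) = D a * b + a * D b) (i : Fin n) :
    ∃ g, D (x k n i) = x k n i * g := by
  refine exists_eq_x_mul fun p hp hpi => ?_
  obtain ⟨j, hji, heven⟩ := exists_even_degree_add hn hpi
  -- The coefficient at `p + single j 1` is compared. Terms with a factor `x k n i` do not reach it,
  -- since this exponent vanishes at `i`. By the choice of `j`, the other two contribute equally,
  -- leaving twice the coefficient of `p`.
  have h0 := congrArg D (x_anticomm (k := k) hji)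
  rw [map_add, map_zero, hD, hD] at h0
  obtain ⟨g, hg, hgp⟩ := exists_x_mul_eq_mul_x j (D (x k n i))
  have hsum : (D (x k n i) + g) * x k n j + (x k n i * D (x k n j) + D (x k n j) * x k n i) = 0 := by
    rw [add_mul, ← hg, ← h0]
    abel
  have hc := congrArg (fun f => (mon k n).repr f (p + single j 1)) hsum
  simp only [map_add, map_zero, Finsupp.add_apply, coe_zero, Pi.zero_apply] at hc
  have hsupp : ∀ l, ∀ q ∈ ((mon k n).repr (x k n l)).support, q = single l 1 := fun l q hq => by
    rw [isMonomial_x l, Finset.mem_singleton] at hq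
    exact hq
  have hpj : (p + single j 1 : Fin n →₀ ℕ) i = 0 := by
    rw [Finsupp.add_apply, hpi, single_eq_of_ne hji.symm, add_zero]
  rw [repr_mul_eq_zero (x k n i), repr_mul_eq_zero _ (x k n i), add_zero, add_zero] at hc
  · obtain ⟨m, hm⟩ := repr_mul_of_unique (D (x k n i) + g) (x k n j) p (single j 1)
      fun p' _ q' hq' h => by
        rw [hsupp j q' hq'] at h ⊢
        exact ⟨add_right_cancel h, rfl⟩
    rw [hc, map_add, Finsupp.add_apply, hgp, heven.neg_one_pow, one_mul, ← mon_single j,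
      Module.Basis.repr_self, single_eq_same, mul_one, ← two_mul] at hm
    exact mul_ne_zero (pow_ne_zero _ (neg_ne_zero.2 one_ne_zero))
      (mul_ne_zero h2.ne_zero (mem_support_iff.1 hp)) hm.symm
  · intro p' _ q' hq' h
    rw [hsupp i q' hq'] at h
    rw [← h, Finsupp.add_apply, single_eq_same] at hpj
    omega
  · intro p' hp' q' _ h
    rw [hsupp i p' hp'] at h
    rw [← h, Finsupp.add_apply, single_eq_same] at hpj
    omega

theorem locallyNilpotentDerivation_eq_zero (h2 : IsUnit (2 : k)) (hn : Even n) (hk : ℚ →+* k)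
    {D : SkewPoly k n →ₗ[k] SkewPoly k n} (hD : IsLocallyNilpotentDerivation D) : D = 0 := by
  have htors : ∀ (m : ℕ) (a : SkewPoly k n), m ≠ 0 → m • a = 0 → a = 0 := by
    intro m a hm h
    have hm' : (m : k) ≠ 0 := by
      rw [← map_natCast hk]
      exact (map_ne_zero hk).2 (Nat.cast_ne_zero.2 hm)
    rw [← Nat.cast_smul_eq_nsmul k, ← smul_one_mul] at h
    exact (mul_eq_zero.1 h).resolve_left fun e =>
      hm' (smul_one_injective (e.trans (zero_smul k _).symm))
  have hx : ∀ i, D (x k n i) = 0 := fun i => by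
    obtain ⟨g, hg⟩ := exists_derivation_x_eq h2 hn hD.1 i
    exact hD.map_eq_zero_of_eq_mul htors hg
  have h1 : D 1 = 0 := by
    have := hD.1 1 1
    rw [mul_one, mul_one, one_mul] at this
    exact (left_eq_add.1 this)
  refine LinearMap.ext fun a => ?_
  have ha : a ∈ Algebra.adjoin k (Set.range (x k n)) := adjoin_range_x (k := k) ▸ trivial
  induction ha using Algebra.adjoin_induction with
  | mem a ha =>
    obtain ⟨i, rfl⟩ := ha
    exact hx i
  | algebraMap r => rw [Algebra.algebraMap_eq_smul_one, map_smul, h1, smul_zero]; rfl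
  | add a b _ _ ha hb => rw [map_add, ha, hb]; exact add_zero _
  | mul a b _ _ ha hb =>
    rw [hD.1, ha, hb]
    simp

end SkewPoly
end DiscAut
end

theorem theorem4p10 (k : Type u) [CommRing k] [IsDomain k] (h2 : IsUnit (2 : k))
    (n : ℕ) (hn : 0 < n) (hne : Even n) :
    -- `k₋₁[x₁, …, xₙ]`, filtered by means of its generators, is in the category `Af`
    DiscAut.InAf.{u, u, w} k (DiscAut.SkewPoly.x k n) ∧
    -- `Aut(k₋₁[x₁, …, xₙ]) = Sₙ ⋉ (k^×)ⁿ`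
    Function.Bijective (DiscAut.SkewPoly.monomialAut (k := k) (n := n)) ∧
    -- `Aut(k₋₁[x₁, …, xₙ][t])` is the triangular group
    (∃ Θ : DiscAut.SkewPoly.Triangular k n ≃*
        (Polynomial (DiscAut.SkewPoly k n) ≃ₐ[k] Polynomial (DiscAut.SkewPoly k n)),
      ∀ m : DiscAut.SkewPoly.Triangular k n,
        (∀ a : DiscAut.SkewPoly k n,
          Θ m (Polynomial.C a) = Polynomial.C (DiscAut.SkewPoly.monomialAut m.g a)) ∧
        Θ m Polynomial.X =
          (m.c : k) • Polynomial.X + Polynomial.C (m.r : DiscAut.SkewPoly k n)) ∧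
    -- if `ℚ ⊆ k`, every locally nilpotent derivation is zero
    (Nonempty (ℚ →+* k) →
      ∀ D : DiscAut.SkewPoly k n →ₗ[k] DiscAut.SkewPoly k n,
        DiscAut.IsLocallyNilpotentDerivation D → D = 0) := by
  refine ⟨DiscAut.SkewPoly.inAf h2 hne, DiscAut.SkewPoly.monomialAut_bijective h2 hne, ?_, ?_⟩
  · exact ⟨MulEquiv.ofBijective DiscAut.SkewPoly.triangularAut
      (DiscAut.SkewPoly.triangularAut_bijective h2 hne), fun m =>
        ⟨DiscAut.SkewPoly.triangularAut_C m, DiscAut.SkewPoly.triangularAut_X m⟩⟩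
  · rintro ⟨hk⟩ D hD
    exact DiscAut.SkewPoly.locallyNilpotentDerivation_eq_zero h2 hne hk hD
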